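/- Conventions. A grading of a real algebra $\mathcal{D}$ by an abelian group $G$ (with neutral element $e$) is a vector space decomposition $\Gamma:\mathcal{D}=\bigoplus_{g\in G}\mathcal{D}_g$ with $\mathcal{D}_g\mathcal{D}_h\subseteq\mathcal{D}_{gh}$; its support is $\{g\mid\mathcal{D}_g\neq0\}$; it is a division grading if every nonzero homogeneous element is invertible. Its homogeneous components have dimension $1$ if $\dim_{\mathbb{R}}\mathcal{D}_g=1$ for every $g$ in the support. Two $G$-gradings on $\mathcal{D}$ are isomorphic if some algebra automorphism $\varphi$ of $\mathcal{D}$ satisfies $\varphi(\mathcal{D}_g)=\mathcal{D}'_g$ for all $g\in G$; gradings on $\mathcal{D}$, $\mathcal{D}'$ (by possibly different groups) are equivalent if there are an algebra isomorphism $\varphi:\mathcal{D}\to\mathcal{D}'$ and a bijection $\alpha$ between the supports with $\varphi(\mathcal{D}_t)=\mathcal{D}'_{\alpha(t)}$ for all $t$ in the support. An alternating bicharacter on an abelian group $T$ is a map $\beta:T\times T\to\mathbb{R}^\times$, multiplicative in each variable, with $\beta(t,t)=1$; its radical is $\mathrm{rad}(\beta)=\{t\mid\beta(u,t)=1\ \forall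 u\in T\}$, and $\beta$ has type II if $\mathrm{rad}(\beta)=\{e,f\}$ for some $f\ne e$. A quadratic form on an elementary abelian $2$-group $T$ is a map $\mu:T\to\{\pm1\}$ with $\mu(e)=1$ such that $\beta_\mu(u,v)=\mu(uv)\mu(u)^{-1}\mu(v)^{-1}$ is multiplicative in each variable; $\beta_\mu$ is its associated alternating bicharacter, and $\mu$ has type II if $\mathrm{rad}(\beta_\mu)=\{e,f\}$ for some $f$ with $\mu(f)=-1$. For an abelian group $T$ put $T_2=\{t\in T\mid t^2=e\}$ and $T^2=\{t^2\mid t\in T\}$. Building blocks. With $\omega=e^{i\pi/4}$, and with each degree indicated in brackets, grade - $M_2(\mathbb{R})$ by $\mathbb{Z}_2^2=\langle a\rangle\times\langle b\rangle$: $\mathbb{R}I\,[e]$, $\mathbb{R}\begin{pmatrix}0&1\\1&0\end{pmatrix}[a]$, $\mathbb{R}\begin{pmatrix}-1&0\\0&1\end{pmatrix}[b]$, $\mathbb{R}\begin{pmatrix}0&-1\\1&0\end{pmatrix}[ab]$; - $\mathbb{C}$ by $\mathbb{Z}_2$: $\mathbb{C}=\mathbb{R}1\oplus\mathbb{R}i$;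 - $M_2(\mathbb{C})$ by $\mathbb{Z}_2\times\mathbb{Z}_4=\langle a\rangle\times\langle b\rangle$: the component of degree $a^jb^k$ is $\mathbb{R}A^jB^k$, where $A=\begin{pmatrix}0&1\\1&0\end{pmatrix}$ and $B=\begin{pmatrix}\omega&0\\0&-\omega\end{pmatrix}$ ($0\le j\le1$, $0\le k\le3$). Tensor products over $\mathbb{R}$ of graded algebras carry the product grading $(\mathcal{D}\otimes\mathcal{D}')_{(g,h)}=\mathcal{D}_g\otimes\mathcal{D}'_h$. **Theorem.** Let $n\ge1$, let $G$ be an abelian group, and let $\mathcal{D}$ be a real algebra isomorphic to $M_n(\mathbb{C})$. If there is a division $G$-grading $\Gamma$ on $\mathcal{D}$ with homogeneous components of dimension $1$, then $n=2^m$ for some integer $m\ge0$, and the support of $\Gamma$ is a subgroup $T$ of $G$ isomorphic either to $\mathbb{Z}_2^{2m+1}$ or (with $m\ge1$) to $\mathbb{Z}_2^{2m-1}\times\mathbb{Z}_4$. Moreover, let $n=2^m$. 1. The isomorphism classes of such gradings on $\mathcal{D}$ with support isomorphic to $\mathbb{Z}_2^{2m+1}$ are in one-to-one correspondence with the pairs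 $(T,\mu)$ formed by a subgroup $T$ of $G$ isomorphic to $\mathbb{Z}_2^{2m+1}$ and a quadratic form $\mu$ on $T$ of type II. The pair attached to a grading consists of its support $T$ and the $\mu$ such that every $\mathcal{D}_t$ ($t\in T$) contains an $X_t$ with $X_t^2=\mu(t)I$. All such gradings belong to one equivalence class, represented by the product grading, by $(\mathbb{Z}_2^2)^m\times\mathbb{Z}_2\cong\mathbb{Z}_2^{2m+1}$, on $M_2(\mathbb{R})\otimes\cdots\otimes M_2(\mathbb{R})\otimes\mathbb{C}\cong M_n(\mathbb{C})$ ($m$ factors $M_2(\mathbb{R})$), which is a division grading with components of dimension $1$ whose support is the whole group. 2. Let $m\ge1$. The isomorphism classes of such gradings on $\mathcal{D}$ with support isomorphic to $\mathbb{Z}_2^{2m-1}\times\mathbb{Z}_4$ are in one-to-one correspondence with the triples $(T,\beta,\mu)$ formed by a subgroup $T$ of $G$ isomorphic to $\mathbb{Z}_2^{2m-1}\times\mathbb{Z}_4$, an alternating bicharacter $\beta$ on $T$ of type II, and a quadratic form $\mu$ on $T_2$, such that the restriction of $\beta$ to $T_2\times T_2$ is the associated alternating bicharacter of $\mu$ and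 $\mu(f)=-1$, where $f$ is the generator of $T^2$. The triple attached to a grading consists of its support $T$, the $\beta$ such that $X_uX_v=\beta(u,v)X_vX_u$ for all $u,v\in T$, $X_u\in\mathcal{D}_u$, $X_v\in\mathcal{D}_v$, and the $\mu$ such that every $\mathcal{D}_t$ ($t\in T_2$) contains an $X_t$ with $X_t^2=\mu(t)I$. All such gradings belong to one equivalence class, represented by the product grading, by $(\mathbb{Z}_2^2)^{m-1}\times(\mathbb{Z}_2\times\mathbb{Z}_4)\cong\mathbb{Z}_2^{2m-1}\times\mathbb{Z}_4$, on $M_2(\mathbb{R})\otimes\cdots\otimes M_2(\mathbb{R})\otimes M_2(\mathbb{C})\cong M_n(\mathbb{C})$ ($m-1$ factors $M_2(\mathbb{R})$), which is a division grading with components of dimension $1$ whose support is the whole group. -/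

import Mathlib

open scoped TensorProduct

noncomputable section

namespace RealGrading

universe u v w

/-! ### Gradings -/

/-- Families of subspaces of the real algebra `D` indexed by `G`. -/
abbrev Family (G : Type*) (D : Type*) [Ring D] [Algebra ℝ D] := G → Submodule ℝ D

section Gradings

variable {G : Type*} {H : Type*} {D : Type*} {D' : Type*}
  [Ring D] [Algebra ℝ D] [Ring D'] [Algebra ℝ D']

/-- `Γ` is a `G`-grading on the real algebra `D`: `D` is the (internal) direct sum of the subspaces
`Γ g`, and `Γ g * Γ h ⊆ Γ (g * h)`. -/
structure IsGrading [Group G] (Γ : Family G D) : Prop where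
  indep : iSupIndep Γ
  iSup_eq_top : ⨆ g, Γ g = ⊤
  mul_mem : ∀ {g h : G} {x y : D}, x ∈ Γ g → y ∈ Γ h → x * y ∈ Γ (g * h)

/-- The support of a grading. -/
def support (Γ : Family G D) : Set G := {g | Γ g ≠ ⊥}

/-- A division grading all of whose (nonzero) homogeneous components have dimension 1. -/
structure IsDimOneDivisionGrading [Group G] (Γ : Family G D) : Prop extends IsGrading Γ where
  isUnit_of_mem : ∀ {g : G} {x : D}, x ∈ Γ g → x ≠ 0 → IsUnit x
  finrank_eq_one : ∀ g ∈ support Γ, Module.finrank ℝ (Γ g) = 1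

/-- The support of `Γ` is a subgroup of `G` that is isomorphic to the group `P`. -/
def SupportIsoTo [Group G] (Γ : Family G D) (P : Type*) [Group P] : Prop :=
  ∃ T : Subgroup G, (T : Set G) = support Γ ∧ Nonempty (T ≃* P)

/-- Isomorphism of two gradings by the same group. -/
def Isomorphic (Γ : Family G D) (Γ' : Family G D') : Prop :=
  ∃ φ : D ≃ₐ[ℝ] D', ∀ g, (Γ g).map φ.toLinearMap = Γ' g

/-- Equivalence of two gradings, possibly by different groups. -/
def Equivalent (Γ : Family G D) (Γ' : Family H D') : Prop :=
  ∃ (φ : D ≃ₐ[ℝ] D') (α : support Γ ≃ support Γ'),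
    ∀ t : support Γ, (Γ t).map φ.toLinearMap = Γ' (α t)

end Gradings

/-- The division `G`-gradings on `D` with homogeneous components of dimension 1 whose support is
isomorphic to the group `P`. -/
def DimOneGrading (G : Type u) [Group G] (D : Type v) [Ring D] [Algebra ℝ D]
    (P : Type w) [Group P] : Type (max u v) :=
  {Γ : Family G D // IsDimOneDivisionGrading Γ ∧ SupportIsoTo Γ P}

instance isoSetoid (G : Type u) [Group G] (D : Type v) [Ring D] [Algebra ℝ D]
    (P : Type w) [Group P] : Setoid (DimOneGrading G D P) where
  r Γ Γ' := Isomorphic Γ.1 Γ'.1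
  iseqv :=
    { refl := fun Γ => ⟨AlgEquiv.refl, fun g => by
        ext x
        simp⟩
      symm := by
        rintro Γ Γ' ⟨φ, h⟩
        refine ⟨φ.symm, fun g => ?_⟩
        rw [← h g]
        ext x
        simp
      trans := by
        rintro Γ Γ' Γ'' ⟨φ, h⟩ ⟨ψ, k⟩
        refine ⟨φ.trans ψ, fun g => ?_⟩
        rw [← k g, ← h g]
        ext x
        simp }

/-- The isomorphism classes of the division `G`-gradings on `D` with homogeneous components of
dimension 1 and support isomorphic to `P`. -/
abbrev IsoClasses (G : Type u) [Group G] (D : Type v) [Ring D] [Algebra ℝ D]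
    (P : Type w) [Group P] : Type (max u v) :=
  Quotient (isoSetoid G D P)

/-! ### Alternating bicharacters and quadratic forms -/

section Forms

variable {T : Type*} [CommGroup T]

/-- A real-valued alternating bicharacter. -/
structure IsAlternatingBicharacter (β : T → T → ℝˣ) : Prop where
  mul_left : ∀ u v w, β (u * v) w = β u w * β v w
  mul_right : ∀ u v w, β u (v * w) = β u v * β u w
  self_eq_one : ∀ t, β t t = 1

/-- The radical of a bicharacter (with values in any group). -/
def radical {M : Type*} [One M] (β : T → T → M) : Set T := {t | ∀ u, β u t = 1}

/-- Type II for a bicharacter: the radical has exactly two elements, `e` and `f`. -/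
def IsTypeII (β : T → T → ℝˣ) : Prop := ∃ f : T, f ≠ 1 ∧ radical β = {1, f}

/-- The map `β(u,v) = μ(uv) μ(u)⁻¹ μ(v)⁻¹` associated with `μ : T → {±1}`. -/
def polar (μ : T → ℤˣ) (u v : T) : ℤˣ := μ (u * v) * (μ u)⁻¹ * (μ v)⁻¹

/-- `μ` is a (multiplicatively written) quadratic form on the elementary abelian 2-group `T`. -/
structure IsQuadraticForm (μ : T → ℤˣ) : Prop where
  elementary : ∀ t : T, t ^ 2 = 1
  map_one : μ 1 = 1
  polar_mul_left : ∀ u v w, polar μ (u * v) w = polar μ u w * polar μ v w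
  polar_mul_right : ∀ u v w, polar μ u (v * w) = polar μ u v * polar μ u w

/-- Type II for a quadratic form: the radical of the associated bicharacter is `{e, f}` with
`μ(f) = -1` (so `f ≠ e`). -/
def IsQuadraticTypeII (μ : T → ℤˣ) : Prop := ∃ f : T, μ f = -1 ∧ radical (polar μ) = {1, f}

variable (T) in
/-- `T_2 = {t ∈ T | t² = e}`. -/
def twoTorsion : Subgroup T := (powMonoidHom 2 : T →* T).ker

variable (T) in
/-- `T² = {t² | t ∈ T}`. -/
def squares : Subgroup T := (powMonoidHom 2 : T →* T).range

end Forms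

/-! ### The classifying data -/

/-- The group with two elements, written multiplicatively. -/
abbrev Z2 : Type := Multiplicative (ZMod 2)

/-- The cyclic group with four elements, written multiplicatively. -/
abbrev Z4 : Type := Multiplicative (ZMod 4)

/-- Pairs `(T, μ)`: a subgroup `T` of `G` isomorphic to `Z_2^{2m+1}` and a quadratic form `μ` on `T`
of type II. -/
@[ext]
structure QuadPair (G : Type u) [CommGroup G] (m : ℕ) where
  T : Subgroup G
  μ : T → ℤˣ
  iso : Nonempty (T ≃* (Fin (2 * m + 1) → Z2))
  quad : IsQuadraticForm μ
  typeII : IsQuadraticTypeII μ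

/-- Triples `(T, β, μ)` (used for `m ≥ 1`): a subgroup `T` of `G` isomorphic to
`Z_2^{2m-1} × Z_4`, an alternating bicharacter `β` on `T` of type II, and a quadratic form `μ` on
`T_2` whose associated alternating bicharacter is the restriction of `β`, with `μ(f) = -1` for the
generator `f` of `T²`. -/
@[ext]
structure QuadTriple (G : Type u) [CommGroup G] (m : ℕ) where
  T : Subgroup G
  β : T → T → ℝˣ
  μ : twoTorsion T → ℤˣ
  iso : Nonempty (T ≃* (Fin (2 * m - 1) → Z2) × Z4)
  alternating : IsAlternatingBicharacter β
  typeII : IsTypeII β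
  quad : IsQuadraticForm μ
  restrict : ∀ u v : twoTorsion T, ((β u v : ℝˣ) : ℝ) = ((polar μ u v : ℤˣ) : ℤ)
  map_gen : ∃ f : twoTorsion T, Subgroup.zpowers (f : T) = squares T ∧ μ f = -1

section Attached

variable {G : Type u} [CommGroup G] {D : Type v} [Ring D] [Algebra ℝ D]

/-- `(T, μ)` is attached to the grading `Γ`: `T` is the support, and each `Γ t` with `t ∈ T`
contains an element `X_t` with `X_t² = μ(t) I`. -/
structure QuadPair.IsAttachedTo {m : ℕ} (p : QuadPair G m) (Γ : Family G D) : Prop where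
  support_eq : (p.T : Set G) = support Γ
  sq_eq : ∀ t : p.T, ∃ X ∈ Γ t, X * X = (((p.μ t : ℤˣ) : ℤ) : ℝ) • (1 : D)

/-- `(T, β, μ)` is attached to the grading `Γ`: `T` is the support, homogeneous elements satisfy
`X_u X_v = β(u,v) X_v X_u`, and each `Γ t` with `t ∈ T_2` contains an element `X_t` with
`X_t² = μ(t) I`. -/
structure QuadTriple.IsAttachedTo {m : ℕ} (p : QuadTriple G m) (Γ : Family G D) : Prop where
  support_eq : (p.T : Set G) = support Γ
  comm_eq : ∀ u v : p.T, ∀ X ∈ Γ u, ∀ Y ∈ Γ v, X * Y = ((p.β u v : ℝˣ) : ℝ) • (Y * X)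
  sq_eq : ∀ t : twoTorsion p.T, ∃ X ∈ Γ ((t : p.T) : G),
    X * X = (((p.μ t : ℤˣ) : ℤ) : ℝ) • (1 : D)

end Attached

/-! ### Representatives of the two equivalence classes -/

/-- The product grading on a tensor product of two graded algebras. -/
def tensorGrading {G H A B : Type*} [Ring A] [Algebra ℝ A] [Ring B] [Algebra ℝ B]
    (Γ : Family G A) (Γ' : Family H B) : Family (G × H) (A ⊗[ℝ] B) :=
  fun p => Submodule.map₂ (TensorProduct.mk ℝ A B) (Γ p.1) (Γ' p.2)

/-- The real algebra `A ⊗ ⋯ ⊗ A` with `k` factors. -/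
def TensorPow (A : Type*) [Ring A] [Algebra ℝ A] (k : ℕ) : Type _ := ⨂[ℝ] _ : Fin k, A

instance (A : Type*) [Ring A] [Algebra ℝ A] (k : ℕ) : Ring (TensorPow A k) :=
  inferInstanceAs (Ring (⨂[ℝ] _ : Fin k, A))

instance (A : Type*) [Ring A] [Algebra ℝ A] (k : ℕ) : Algebra ℝ (TensorPow A k) :=
  inferInstanceAs (Algebra ℝ (⨂[ℝ] _ : Fin k, A))

/-- The pure tensor `x_1 ⊗ ⋯ ⊗ x_k`. -/
def TensorPow.pure {A : Type*} [Ring A] [Algebra ℝ A] {k : ℕ} (x : Fin k → A) : TensorPow A k :=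
  PiTensorProduct.tprod ℝ x

/-- The product grading on the tensor product of `k` copies of a graded algebra. -/
def tensorPowerGrading {G A : Type*} [Ring A] [Algebra ℝ A] (Γ : Family G A) (k : ℕ) :
    Family (Fin k → G) (TensorPow A k) :=
  fun g => Submodule.span ℝ
    {z | ∃ x : Fin k → A, (∀ i, x i ∈ Γ (g i)) ∧ z = TensorPow.pure x}

/-- The `Z_2²`-grading on `M_2(ℝ)`: the component of degree `(i, j)` is spanned by the entry `(i, j)`
of the table. -/
def gradingM2R : Family (Z2 × Z2) (Matrix (Fin 2) (Fin 2) ℝ) := fun g =>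
  let table : Fin 2 → Fin 2 → Matrix (Fin 2) (Fin 2) ℝ :=
    ![![!![1, 0; 0, 1], !![-1, 0; 0, 1]],
      ![!![0, 1; 1, 0], !![0, -1; 1, 0]]]
  Submodule.span ℝ {table (Multiplicative.toAdd g.1) (Multiplicative.toAdd g.2)}

/-- The `Z_2`-grading `ℂ = ℝ1 ⊕ ℝi`. -/
def gradingC : Family Z2 ℂ := fun g =>
  let table : Fin 2 → ℂ := ![1, Complex.I]
  Submodule.span ℝ {table (Multiplicative.toAdd g)}

/-- `ω = e^{iπ/4}`. -/
def omega : ℂ := Complex.exp (Complex.I * Real.pi / 4)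

/-- The `Z_2 × Z_4`-grading on `M_2(ℂ)`: the component of degree `(i, j)`, that is, `a^i b^j`, is
spanned by the entry `(i, j)` of the table. -/
def gradingM2C : Family (Z2 × Z4) (Matrix (Fin 2) (Fin 2) ℂ) := fun g =>
  let table : Fin 2 → Fin 4 → Matrix (Fin 2) (Fin 2) ℂ :=
    ![![!![1, 0; 0, 1], !![omega, 0; 0, -omega],
        !![Complex.I, 0; 0, Complex.I], !![omega ^ 3, 0; 0, -omega ^ 3]],
      ![!![0, 1; 1, 0], !![0, -omega; omega, 0],
        !![0, Complex.I; Complex.I, 0], !![0, -omega ^ 3; omega ^ 3, 0]]]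
  Submodule.span ℝ {table (Multiplicative.toAdd g.1) (Multiplicative.toAdd g.2)}

/-- The algebra `M_2(ℝ) ⊗ ⋯ ⊗ M_2(ℝ) ⊗ ℂ` with `m` factors `M_2(ℝ)`. -/
abbrev AlgebraOne (m : ℕ) : Type := TensorPow (Matrix (Fin 2) (Fin 2) ℝ) m ⊗[ℝ] ℂ

/-- The product grading on `M_2(ℝ) ⊗ ⋯ ⊗ M_2(ℝ) ⊗ ℂ` by `(Z_2²)^m × Z_2`. -/
def modelOne (m : ℕ) : Family ((Fin m → Z2 × Z2) × Z2) (AlgebraOne m) :=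
  tensorGrading (tensorPowerGrading gradingM2R m) gradingC

/-- The algebra `M_2(ℝ) ⊗ ⋯ ⊗ M_2(ℝ) ⊗ M_2(ℂ)` with `m - 1` factors `M_2(ℝ)` (for `m ≥ 1`). -/
abbrev AlgebraTwo (m : ℕ) : Type :=
  TensorPow (Matrix (Fin 2) (Fin 2) ℝ) (m - 1) ⊗[ℝ] Matrix (Fin 2) (Fin 2) ℂ

/-- The product grading on `M_2(ℝ) ⊗ ⋯ ⊗ M_2(ℝ) ⊗ M_2(ℂ)` by `(Z_2²)^{m-1} × (Z_2 × Z_4)`. -/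
def modelTwo (m : ℕ) : Family ((Fin (m - 1) → Z2 × Z2) × (Z2 × Z4)) (AlgebraTwo m) :=
  tensorGrading (tensorPowerGrading gradingM2R (m - 1)) gradingM2C

end RealGrading

end

open RealGrading

/-!
A division grading `Γ` with one-dimensional components on `D ≅ M_n(ℂ)` is the same thing as a
homogeneous basis `X_t` of `D`, indexed by the support `T`, with `X_1 = 1` and
`X_u X_v = σ(u, v) X_{uv}` for real numbers `σ(u, v) ≠ 0`: the algebra `D` is a twisted group algebra
of the finite abelian group `T` (`IsHomogeneousBasis`, `IsDimOneDivisionGrading.exists_basis`). So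
`|T| = 2n²`.

*Invariants.* The commutation factor `β(u, v) = σ(u, v) / σ(v, u)` is an alternating bicharacter with
values `±1`. The center of `D` is spanned by the `X_t` with `t` in the radical of `β`; as the center
is `ℂ`, the radical is `{1, f}` and `X_f²` is negative (`IsTwisted.exists_radical_eq`). All squares
`t²` lie in the radical, so either `T` is elementary or `T² = {1, f}`. Where `t² = 1`, the sign of
`X_t²` is a quadratic form `μ`, and its polarisation is `β` (`IsTwisted.comm_eq_polar`).

*The invariants determine the grading.* If two twisted group algebras of `T` have the same `β` and
`μ`, the quotient of their cocycles is symmetric, so it defines an abelian extension of `T`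
by `ℝˣ`. The equality of the `μ` and the exponent `4` of `T` allow every element of `T` to be lifted
with its order, so the extension splits (`exists_cobounding`), which yields a graded isomorphism
(`IsTwisted.exists_algEquiv`).

*Normal forms.* A quadratic form of type II splits off hyperbolic planes until only the radical is
left (`IsQuadraticForm.exists_normalForm`); Arf invariants play no role, because multiplication by
`f` changes the sign of `μ` but not the pairings. If `T² = {1, f}`, duality of finite abelian groups
gives an `a` such that `β(a, ·)` detects the elements of order four; for any `b` with `b² = f`, the
orthogonal complement of `a, b` is elementary, and the previous case applies to it
(`exists_normalForm_bicharacter`). These normal forms are the invariants of the two product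
gradings. Thus all gradings of one kind are equivalent to the product grading, and all invariants
occur, by transport of the product grading.
-/

open Module
open scoped TensorProduct

noncomputable section

namespace RealGrading

/-! ### Homogeneous bases -/

section Twisted

variable {T D : Type*} [CommGroup T] [Ring D] [Algebra ℝ D]

lemma smul_basis_inj {T D : Type*} [Ring D] [Algebra ℝ D] {b : Basis T ℝ D} {t : T} {c d : ℝ}
    (h : c • b t = d • b t) : c = d :=
  smul_left_injective ℝ (b.ne_zero t) h

/-- A basis of `D` indexed by a group `T` presents `D` as a twisted group algebra of `T`: products
of basis elements are nonzero multiples of basis elements, as prescribed by the group law. -/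
structure IsTwisted (b : Basis T ℝ D) : Prop where
  one : b 1 = 1
  exists_mul : ∀ u v, ∃ c : ℝˣ, b u * b v = (c : ℝ) • b (u * v)

namespace IsTwisted

variable {b : Basis T ℝ D} (hb : IsTwisted b)

/-- The structure constants of a twisted group algebra. -/
def cocycle (hb : IsTwisted b) (u v : T) : ℝˣ := (hb.exists_mul u v).choose

lemma mul (u v : T) : b u * b v = (hb.cocycle u v : ℝ) • b (u * v) :=
  (hb.exists_mul u v).choose_spec

lemma cocycle_assoc (u v w : T) :
    hb.cocycle u v * hb.cocycle (u * v) w = hb.cocycle v w * hb.cocycle u (v * w) := by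
  have h := mul_assoc (b u) (b v) (b w)
  rw [hb.mul u v, hb.mul v w, smul_mul_assoc, mul_smul_comm, hb.mul, hb.mul, smul_smul, smul_smul,
    mul_assoc u v w] at h
  exact Units.ext (smul_basis_inj h)

lemma cocycle_one_left (v : T) : hb.cocycle 1 v = 1 := by
  have h := hb.mul 1 v
  rw [hb.one, one_mul, one_mul] at h
  exact Units.ext (smul_basis_inj (by rw [← h, Units.val_one, one_smul]))

include hb in
lemma isUnit (t : T) : IsUnit (b t) := by
  have h : ∀ u v : T, u * v = 1 → ∃ y : D, b u * y = 1 := by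
    intro u v huv
    refine ⟨((hb.cocycle u v)⁻¹ : ℝˣ).val • b v, ?_⟩
    rw [mul_smul_comm, hb.mul, huv, hb.one, smul_smul, ← Units.val_mul, inv_mul_cancel,
      Units.val_one, one_smul]
  have h' : ∀ u v : T, u * v = 1 → ∃ y : D, y * b v = 1 := by
    intro u v huv
    refine ⟨((hb.cocycle u v)⁻¹ : ℝˣ).val • b u, ?_⟩
    rw [smul_mul_assoc, hb.mul, huv, hb.one, smul_smul, ← Units.val_mul, inv_mul_cancel,
      Units.val_one, one_smul]
  exact isUnit_iff_exists_and_exists.2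
    ⟨h t t⁻¹ (mul_inv_cancel t), h' t⁻¹ t (inv_mul_cancel t)⟩

/-- The commutation factor of a twisted group algebra of an abelian group. -/
def comm (hb : IsTwisted b) (u v : T) : ℝˣ := hb.cocycle u v / hb.cocycle v u

lemma mul_comm_eq (u v : T) : b u * b v = (hb.comm u v : ℝ) • (b v * b u) := by
  rw [hb.mul u v, hb.mul v u, smul_smul, ← Units.val_mul, comm, div_mul_cancel, mul_comm v u]

lemma comm_unique {u v : T} {c : ℝ} (h : b u * b v = c • (b v * b u)) : c = hb.comm u v := by
  rw [hb.mul_comm_eq u v, hb.mul v u, smul_smul, smul_smul] at h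
  exact (mul_right_cancel₀ (Units.ne_zero _) (smul_basis_inj h)).symm

lemma comm_mul_left (u v w : T) : hb.comm (u * v) w = hb.comm u w * hb.comm v w := by
  refine (Units.ext (hb.comm_unique ?_)).symm
  apply smul_right_injective D (hb.cocycle u v).ne_zero
  simp only
  rw [← smul_mul_assoc, ← hb.mul, smul_comm, ← mul_smul_comm, ← hb.mul, mul_assoc,
    hb.mul_comm_eq v w, mul_smul_comm, ← mul_assoc, hb.mul_comm_eq u w, smul_mul_assoc, smul_smul,
    mul_assoc, mul_comm (hb.comm u w), Units.val_mul]

lemma comm_symm (u v : T) : hb.comm u v * hb.comm v u = 1 := by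
  simp [comm]

lemma comm_mul_right (u v w : T) : hb.comm u (v * w) = hb.comm u v * hb.comm u w := by
  have h := fun x y => eq_inv_of_mul_eq_one_left (hb.comm_symm x y)
  rw [h u, comm_mul_left, mul_inv, ← h, ← h]

lemma isAlternatingBicharacter : IsAlternatingBicharacter hb.comm where
  mul_left := hb.comm_mul_left
  mul_right := hb.comm_mul_right
  self_eq_one t := by simp [comm]

/-- Squares of basis elements determine the commutation factor at involutions, because the
commutation factor takes there the values `±1` only. -/
lemma comm_eq_polar {μ : T → ℤˣ} {u v : T} (hv : v * v = 1)
    (h1 : b u * b u = (((μ u : ℤˣ) : ℤ) : ℝ) • (1 : D))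
    (h2 : b v * b v = (((μ v : ℤˣ) : ℤ) : ℝ) • (1 : D))
    (h3 : b (u * v) * b (u * v) = (((μ (u * v) : ℤˣ) : ℤ) : ℝ) • (1 : D)) :
    ((hb.comm u v : ℝˣ) : ℝ) = ((polar μ u v : ℤˣ) : ℤ) := by
  have hsq : ∀ w, hb.comm w v * hb.comm w v = 1 := fun w => by
    rw [← hb.comm_mul_right, hv]
    simpa using hb.comm_mul_right w 1 1
  have key : ((hb.cocycle u v : ℝ) * hb.cocycle u v * (((μ (u * v) : ℤˣ) : ℤ) : ℝ)) • b 1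
      = ((hb.comm v u : ℝ) * (((μ u : ℤˣ) : ℤ) : ℝ) * (((μ v : ℤˣ) : ℤ) : ℝ)) • b 1 := by
    have e : (b u * b v) * (b u * b v) = b u * ((b v * b u) * b v) := by noncomm_ring
    rw [hb.mul_comm_eq v u] at e
    rw [smul_mul_assoc, mul_smul_comm,
      show b u * (b u * b v * b v) = (b u * b u) * (b v * b v) by noncomm_ring, h1, h2,
      smul_mul_smul_comm, one_mul, smul_smul, hb.mul u v, smul_mul_smul_comm, h3, smul_smul,
      ← hb.one] at e
    rw [e, mul_assoc]
  have key := smul_basis_inj key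
  have hvu : hb.comm v u = hb.comm u v := by
    rw [eq_inv_of_mul_eq_one_left (hb.comm_symm v u), inv_eq_of_mul_eq_one_left (hsq u)]
  rw [hvu] at key
  have hpos : 0 < (hb.cocycle u v : ℝ) * hb.cocycle u v :=
    mul_self_pos.2 (Units.ne_zero _)
  have hc : (hb.comm u v : ℝ) * hb.comm u v = 1 := by
    rw [← Units.val_mul, hsq, Units.val_one]
  rcases mul_self_eq_one_iff.1 hc with h | h <;> rw [h] at key ⊢ <;> unfold polar <;>
    rcases Int.units_eq_one_or (μ u) with h1 | h1 <;>
    rcases Int.units_eq_one_or (μ v) with h2 | h2 <;>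
    rcases Int.units_eq_one_or (μ (u * v)) with h3 | h3 <;>
    simp only [h1, h2, h3] at key ⊢ <;> norm_num at key ⊢ <;> linarith

end IsTwisted

end Twisted

section Homogeneous

variable {G D : Type*} [CommGroup G] [Ring D] [Algebra ℝ D]

/-- `b` is a basis of `D` consisting of homogeneous elements, one for each degree in `T`, with
`b 1 = 1` and with all products of basis elements nonzero. -/
structure IsHomogeneousBasis (Γ : Family G D) (T : Subgroup G) (b : Basis T ℝ D) : Prop
    extends IsTwisted b where
  eq_span : ∀ t : T, Γ t = Submodule.span ℝ {b t}
  eq_bot : ∀ g ∉ T, Γ g = ⊥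

namespace IsHomogeneousBasis

variable {Γ : Family G D} {T : Subgroup G} {b : Basis T ℝ D} (hb : IsHomogeneousBasis Γ T b)

include hb

lemma mem_iff {t : T} {x : D} : x ∈ Γ t ↔ ∃ c : ℝ, c • b t = x := by
  rw [hb.eq_span, Submodule.mem_span_singleton]

lemma basis_mem (t : T) : b t ∈ Γ t := hb.mem_iff.2 ⟨1, one_smul _ _⟩

lemma support_eq : (T : Set G) = support Γ := by
  ext g
  by_cases hg : g ∈ T
  · have : Γ g ≠ ⊥ := by
      rw [hb.eq_span ⟨g, hg⟩, Ne, Submodule.span_singleton_eq_bot]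
      exact b.ne_zero _
    simp [support, hg, this]
  · simp [support, hg, hb.eq_bot g hg]

lemma isDimOneDivisionGrading : IsDimOneDivisionGrading Γ where
  indep := by
    intro g
    by_cases hg : g ∈ T
    · have h := b.linearIndependent.iSupIndep_span_singleton ⟨g, hg⟩
      rw [hb.eq_span ⟨g, hg⟩]
      refine h.mono_right ?_
      refine iSup₂_le fun j hj => ?_
      by_cases hjT : j ∈ T
      · rw [hb.eq_span ⟨j, hjT⟩]
        exact le_iSup₂_of_le (f := fun (s : T) (_ : s ≠ ⟨g, hg⟩) => Submodule.span ℝ {b s})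
          ⟨j, hjT⟩ (fun h => hj (congrArg Subtype.val h)) le_rfl
      · rw [hb.eq_bot j hjT]
        exact bot_le
    · rw [hb.eq_bot g hg]
      exact disjoint_bot_left
  iSup_eq_top := by
    rw [eq_top_iff, ← b.span_eq, Submodule.span_le]
    rintro _ ⟨t, rfl⟩
    exact Submodule.mem_iSup_of_mem (t : G) (hb.basis_mem t)
  mul_mem := by
    intro g h x y hx hy
    by_cases hg : g ∈ T
    · by_cases hh : h ∈ T
      · obtain ⟨c, rfl⟩ := (hb.mem_iff (t := ⟨g, hg⟩)).1 hx
        obtain ⟨d, rfl⟩ := (hb.mem_iff (t := ⟨h, hh⟩)).1 hy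
        refine (hb.mem_iff (t := ⟨g, hg⟩ * ⟨h, hh⟩)).2
          ⟨c * d * hb.toIsTwisted.cocycle ⟨g, hg⟩ ⟨h, hh⟩, ?_⟩
        rw [smul_mul_smul_comm, hb.toIsTwisted.mul, smul_smul]
      · rw [hb.eq_bot h hh, Submodule.mem_bot] at hy
        simp [hy]
    · rw [hb.eq_bot g hg, Submodule.mem_bot] at hx
      simp [hx]
  isUnit_of_mem := by
    intro g x hx hx0
    by_cases hg : g ∈ T
    · obtain ⟨c, rfl⟩ := (hb.mem_iff (t := ⟨g, hg⟩)).1 hx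
      have hc : c ≠ 0 := by
        rintro rfl
        simp at hx0
      exact (hb.toIsTwisted.isUnit _).smul (Units.mk0 c hc)
    · rw [hb.eq_bot g hg, Submodule.mem_bot] at hx
      exact absurd hx hx0
  finrank_eq_one := by
    intro g hg
    rw [← hb.support_eq] at hg
    rw [hb.eq_span ⟨g, hg⟩]
    exact finrank_span_singleton (b.ne_zero _)

/-- Any two homogeneous elements commute up to the commutation factor of the basis. -/
lemma comm_eq (u v : T) {X Y : D} (hX : X ∈ Γ u) (hY : Y ∈ Γ v) :
    X * Y = ((hb.toIsTwisted.comm u v : ℝˣ) : ℝ) • (Y * X) := by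
  obtain ⟨c, rfl⟩ := hb.mem_iff.1 hX
  obtain ⟨d, rfl⟩ := hb.mem_iff.1 hY
  rw [smul_mul_smul_comm, smul_mul_smul_comm, hb.toIsTwisted.mul_comm_eq u v, smul_comm,
    mul_comm c d]

/-- The square of a homogeneous element of order two can be normalised to `±1`. -/
lemma exists_normalized : ∃ (b' : Basis T ℝ D) (μ : T → ℤˣ), IsHomogeneousBasis Γ T b' ∧
    ∀ t, t * t = 1 → b' t * b' t = (((μ t : ℤˣ) : ℤ) : ℝ) • (1 : D) := by
  have hc := hb.toIsTwisted
  set σ := hc.cocycle with hσ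
  have hpos : ∀ t, 0 < √|(σ t t : ℝ)| := fun t => Real.sqrt_pos.2 (abs_pos.2 (Units.ne_zero _))
  let w : T → ℝˣ := fun t => (Units.mk0 _ (hpos t).ne')⁻¹
  have hw : ∀ t, (w t : ℝ) * w t = |(σ t t : ℝ)|⁻¹ := fun t => by
    simp only [w, Units.val_inv_eq_inv_val, Units.val_mk0]
    rw [← mul_inv, Real.mul_self_sqrt (abs_nonneg _)]
  refine ⟨b.unitsSMul w, fun t => if 0 < (σ t t : ℝ) then 1 else -1, ⟨⟨?_, ?_⟩, ?_, hb.eq_bot⟩, ?_⟩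
  · have : w 1 = 1 := by
      ext
      simp [w, hσ, hc.cocycle_one_left]
    rw [Basis.unitsSMul_apply, this, one_smul, hc.one]
  · intro u v
    refine ⟨w u * w v * σ u v * (w (u * v))⁻¹, ?_⟩
    simp only [Basis.unitsSMul_apply, Units.smul_def]
    rw [smul_mul_smul_comm, hc.mul, smul_smul, smul_smul, ← Units.val_mul, ← Units.val_mul,
      ← Units.val_mul, inv_mul_cancel_right]
  · intro t
    rw [Basis.unitsSMul_apply, hb.eq_span, Units.smul_def]
    exact (Submodule.span_singleton_smul_eq (w t).isUnit _).symm
  · intro t ht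
    simp only [Basis.unitsSMul_apply, Units.smul_def]
    rw [smul_mul_smul_comm, hc.mul, smul_smul, ht, hc.one, hw, ← hσ]
    congr 1
    split_ifs with h
    · rw [abs_of_pos h]
      simp
    · have h' : (σ t t : ℝ) < 0 := lt_of_le_of_ne (not_lt.1 h) (Units.ne_zero _)
      rw [abs_of_neg h', inv_neg, neg_mul]
      simp

end IsHomogeneousBasis

/-- A division grading with one-dimensional components on a nonzero finite-dimensional algebra has a
homogeneous basis; in particular its support is a subgroup. -/
lemma IsDimOneDivisionGrading.exists_basis [Nontrivial D] [FiniteDimensional ℝ D]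
    {Γ : Family G D} (hΓ : IsDimOneDivisionGrading Γ) :
    ∃ (T : Subgroup G) (b : Basis T ℝ D), IsHomogeneousBasis Γ T b := by
  have hfin : (support Γ).Finite := WellFoundedGT.finite_ne_bot_of_iSupIndep hΓ.indep
  have hne : (support Γ).Nonempty := by
    by_contra! h
    have : ∀ g, Γ g = ⊥ := fun g => by
      by_contra hg
      exact (Set.eq_empty_iff_forall_notMem.1 h g) hg
    have h2 := hΓ.iSup_eq_top
    simp [this] at h2
  have mem_of : ∀ {g : G} {x : D}, x ∈ Γ g → x ≠ 0 → g ∈ support Γ := by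
    intro g x hx hx0 h
    rw [h, Submodule.mem_bot] at hx
    exact hx0 hx
  have hmul : ∀ {g h : G}, g ∈ support Γ → h ∈ support Γ → g * h ∈ support Γ := by
    intro g h hg hh
    obtain ⟨x, hx, hx0⟩ := Submodule.exists_mem_ne_zero_of_ne_bot hg
    obtain ⟨y, hy, hy0⟩ := Submodule.exists_mem_ne_zero_of_ne_bot hh
    exact mem_of (hΓ.mul_mem hx hy)
      ((hΓ.isUnit_of_mem hx hx0).mul (hΓ.isUnit_of_mem hy hy0)).ne_zero
  -- a finite nonempty subset of a group that is closed under products is a subgroup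
  have hpow : ∀ {g : G}, g ∈ support Γ → ∀ k : ℕ, g ^ (k + 1) ∈ support Γ := by
    intro g hg k
    induction k with
    | zero => simpa using hg
    | succ k ih => rw [pow_succ]; exact hmul ih hg
  have hinv : ∀ {g : G}, g ∈ support Γ → ∃ k : ℕ, g ^ (k + 1) = 1 := by
    intro g hg
    have : ¬ Function.Injective fun k : ℕ => (⟨g ^ (k + 1), hpow hg k⟩ : support Γ) := by
      intro hinj
      have := hfin.to_subtype
      exact not_injective_infinite_finite _ hinj
    simp only [Function.Injective, not_forall, Subtype.mk.injEq] at this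
    obtain ⟨i, j, hij, hne⟩ := this
    wlog hlt : i < j generalizing i j
    · exact this j i hij.symm (Ne.symm hne) (by omega)
    obtain ⟨d, rfl⟩ := Nat.exists_eq_add_of_lt hlt
    refine ⟨d, ?_⟩
    rw [show i + d + 1 + 1 = (i + 1) + (d + 1) by ring, pow_add g (i + 1)] at hij
    exact (mul_eq_left.1 hij.symm)
  have hone : (1 : G) ∈ support Γ := by
    obtain ⟨g, hg⟩ := hne
    obtain ⟨k, hk⟩ := hinv hg
    exact hk ▸ hpow hg k
  let T : Subgroup G :=
    { carrier := support Γ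
      mul_mem' := hmul
      one_mem' := hone
      inv_mem' := by
        intro g hg
        obtain ⟨k, hk⟩ := hinv hg
        rcases k with _ | k
        · have : g = 1 := by simpa using hk
          simpa [this] using hone
        · rw [inv_eq_of_mul_eq_one_left (by rw [← pow_succ, hk] : g ^ (k + 1) * g = 1)]
          exact hpow hg k }
  -- a nonzero `z` of degree `1` satisfies `z² = c z`, and it is a unit, so `z = c`
  have hone_mem : (1 : D) ∈ Γ 1 := by
    obtain ⟨z, hz, hz0⟩ := Submodule.exists_mem_ne_zero_of_ne_bot hone
    have hzz : z * z ∈ Γ 1 := by simpa using hΓ.mul_mem hz hz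
    obtain ⟨c, hc⟩ := (finrank_eq_one_iff_of_nonzero' (⟨z, hz⟩ : Γ 1)
      (by simpa using hz0)).1 (hΓ.finrank_eq_one 1 hone) ⟨z * z, hzz⟩
    have hc : c • z = z * z := congrArg Subtype.val hc
    have hu := hΓ.isUnit_of_mem hz hz0
    have : c • (1 : D) = z := by
      apply hu.mul_left_cancel
      rw [mul_smul_comm, mul_one, hc]
    have hc0 : c ≠ 0 := by
      rintro rfl
      exact hz0 (by rw [← this, zero_smul])
    have h2 : (1 : D) = c⁻¹ • z := by rw [← this, smul_smul, inv_mul_cancel₀ hc0, one_smul]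
    rw [h2]
    exact Submodule.smul_mem _ _ hz
  have hex : ∀ t : T, ∃ x : D, x ∈ Γ t ∧ x ≠ 0 ∧ (t = 1 → x = 1) := by
    intro t
    by_cases ht : t = 1
    · exact ⟨1, by simpa [ht] using hone_mem, one_ne_zero, fun _ => rfl⟩
    · obtain ⟨x, hx, hx0⟩ := Submodule.exists_mem_ne_zero_of_ne_bot (p := Γ t) t.2
      exact ⟨x, hx, hx0, fun h => absurd h ht⟩
  choose X hX hX0 hX1 using hex
  have hspan : ∀ t : T, Γ t = Submodule.span ℝ {X t} := by
    intro t
    refine le_antisymm (fun y hy => ?_) ?_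
    · obtain ⟨c, hc⟩ := (finrank_eq_one_iff_of_nonzero' (⟨X t, hX t⟩ : Γ t)
        (by simpa using hX0 t)).1 (hΓ.finrank_eq_one t t.2) ⟨y, hy⟩
      exact Submodule.mem_span_singleton.2 ⟨c, congrArg Subtype.val hc⟩
    · rw [Submodule.span_singleton_le_iff_mem]
      exact hX t
  have hbot : ∀ g ∉ T, Γ g = ⊥ := fun g hg => by
    by_contra h
    exact hg h
  have hli : LinearIndependent ℝ X :=
    (hΓ.indep.comp Subtype.val_injective).linearIndependent _ hX hX0
  have htop : ⊤ ≤ Submodule.span ℝ (Set.range X) := by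
    rw [← hΓ.iSup_eq_top]
    refine iSup_le fun g => ?_
    by_cases hg : g ∈ T
    · rw [hspan ⟨g, hg⟩]
      exact Submodule.span_mono (by rintro _ rfl; exact ⟨_, rfl⟩)
    · rw [hbot g hg]
      exact bot_le
  refine ⟨T, Basis.mk hli htop, ⟨⟨?_, ?_⟩, ?_, hbot⟩⟩
  · rw [Basis.mk_apply]
    exact hX1 1 rfl
  · intro u v
    simp only [Basis.mk_apply]
    have h := hΓ.mul_mem (hX u) (hX v)
    rw [show ((u : G) * v) = ((u * v : T) : G) from rfl, hspan,
      Submodule.mem_span_singleton] at h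
    obtain ⟨c, hc⟩ := h
    have hc0 : c ≠ 0 := by
      rintro rfl
      rw [zero_smul] at hc
      exact ((hΓ.isUnit_of_mem (hX u) (hX0 u)).mul (hΓ.isUnit_of_mem (hX v) (hX0 v))).ne_zero
        hc.symm
    exact ⟨Units.mk0 c hc0, hc.symm⟩
  · intro t
    rw [Basis.mk_apply]
    exact hspan t

end Homogeneous

/-! ### The center -/

/-- The center of an algebra isomorphic to
`M_n(ℂ)` is spanned by `1` and a square root `J` of `-1`. -/
lemma exists_center_generator {D : Type*} [Ring D] [Algebra ℝ D] {n : ℕ} (hn : 1 ≤ n)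
    (e : D ≃ₐ[ℝ] Matrix (Fin n) (Fin n) ℂ) :
    ∃ J : D, J * J = -1 ∧ (∀ y, J * y = y * J) ∧
      ∀ x : D, (∀ y, x * y = y * x) → ∃ r s : ℝ, x = r • (1 : D) + s • J := by
  have : NeZero n := ⟨by omega⟩
  have hsm : ∀ (z : ℂ), e.symm (Matrix.scalar (Fin n) z)
      = z.re • (1 : D) + z.im • e.symm (Matrix.scalar (Fin n) Complex.I) := by
    intro z
    apply e.injective
    rw [map_add, map_smul, map_smul, map_one, e.apply_symm_apply, e.apply_symm_apply]
    ext i j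
    by_cases hij : i = j
    · subst hij
      apply Complex.ext <;> simp
    · simp [hij]
  refine ⟨e.symm (Matrix.scalar (Fin n) Complex.I), ?_, ?_, ?_⟩
  · apply e.injective
    rw [map_mul, e.apply_symm_apply, ← map_mul, Complex.I_mul_I, map_neg, map_neg, map_one, map_one]
  · intro y
    apply e.injective
    rw [map_mul, map_mul, e.apply_symm_apply]
    exact (Matrix.scalar_commute _ (fun r => Commute.all _ r) _)
  · intro x hx
    have hc : e x ∈ Set.range (Matrix.scalar (Fin n) : ℂ → _) := by
      apply Matrix.mem_range_scalar_of_commute_single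
      intro i j _
      have h := congrArg e (hx (e.symm (Matrix.single i j 1)))
      rw [map_mul, map_mul, e.apply_symm_apply] at h
      exact h.symm
    obtain ⟨z, hz⟩ := hc
    refine ⟨z.re, z.im, ?_⟩
    rw [← hsm, hz, e.symm_apply_apply]

lemma IsTwisted.mul_eq_mul_of_mem_radical {T D : Type*} [CommGroup T] [Ring D] [Algebra ℝ D]
    {b : Basis T ℝ D} (hb : IsTwisted b) {t : T} (ht : t ∈ radical hb.comm) (y : D) :
    b t * y = y * b t := by
  have h : ∀ u, b t * b u = b u * b t := fun u => by
    rw [hb.mul_comm_eq u t, ht u, Units.val_one, one_smul]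
  have : LinearMap.mulLeft ℝ (b t) = LinearMap.mulRight ℝ (b t) := b.ext fun u => h u
  exact LinearMap.congr_fun this y

/-- A basis element that occurs in a central element lies in the radical of the commutation
factor. -/
lemma IsTwisted.mem_radical_of_central {T D : Type*} [CommGroup T] [Ring D] [Algebra ℝ D]
    {b : Basis T ℝ D} (hb : IsTwisted b) {x : D} (hx : ∀ y, x * y = y * x) {t : T}
    (ht : b.repr x t ≠ 0) : t ∈ radical hb.comm := by
  intro u
  -- conjugation by `b u` multiplies the coordinate at `t` by the commutation factor
  have key : ∀ x : D, b.repr (b u * x) (u * t)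
      = hb.comm u t * b.repr (x * b u) (u * t) := by
    have : (b.coord (u * t)) ∘ₗ LinearMap.mulLeft ℝ (b u)
        = (hb.comm u t : ℝ) • ((b.coord (u * t)) ∘ₗ LinearMap.mulRight ℝ (b u)) := by
      refine b.ext fun s => ?_
      simp only [LinearMap.comp_apply, LinearMap.smul_apply, LinearMap.mulLeft_apply,
        LinearMap.mulRight_apply, smul_eq_mul]
      by_cases hs : s = t
      · subst hs
        rw [hb.mul_comm_eq u s, map_smul, smul_eq_mul]
      · rw [hb.mul, hb.mul, mul_comm s u]
        have : u * s ≠ u * t := fun h => hs (mul_left_cancel h)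
        simp [this]
    intro x
    exact LinearMap.congr_fun this x
  have hne : b.repr (x * b u) (u * t) ≠ 0 := by
    have : ∀ x : D, b.repr (x * b u) (u * t) = hb.cocycle t u * b.repr x t := by
      have : (b.coord (u * t)) ∘ₗ LinearMap.mulRight ℝ (b u)
          = (hb.cocycle t u : ℝ) • b.coord t := by
        refine b.ext fun s => ?_
        simp only [LinearMap.comp_apply, LinearMap.smul_apply, LinearMap.mulRight_apply,
          smul_eq_mul, hb.mul, map_smul]
        by_cases hs : s = t
        · subst hs
          simp [mul_comm s u]
        · have : s * u ≠ u * t := fun h => hs (mul_right_cancel (h.trans (mul_comm _ _)))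
          simp [this, hs]
      intro x
      exact LinearMap.congr_fun this x
    rw [this]
    exact mul_ne_zero (Units.ne_zero _) ht
  have h := key x
  rw [← hx] at h
  exact Units.ext (mul_right_cancel₀ hne (by rw [← h, Units.val_one, one_mul]))

/-- If the center is a copy of `ℂ`, the commutation factor has type II, and the basis element in the
nontrivial degree of its radical has a negative square. -/
lemma IsTwisted.exists_radical_eq {T D : Type*} [CommGroup T] [Ring D] [Algebra ℝ D]
    {b : Basis T ℝ D} (hb : IsTwisted b) {n : ℕ} (hn : 1 ≤ n)
    (e : D ≃ₐ[ℝ] Matrix (Fin n) (Fin n) ℂ) :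
    ∃ f : T, f ≠ 1 ∧ radical hb.comm = {1, f} ∧ f * f = 1 ∧
      ∃ r : ℝ, r < 0 ∧ b f * b f = r • (1 : D) := by
  obtain ⟨J, hJ, hJc, hgen⟩ := exists_center_generator hn e
  have h1D : (1 : D) ≠ 0 := hb.one ▸ b.ne_zero 1
  have hreal : ∀ c : ℝ, c • (1 : D) ≠ J := by
    rintro c rfl
    rw [smul_mul_smul_comm, one_mul, eq_neg_iff_add_eq_zero] at hJ
    have : (c * c + 1) • (1 : D) = 0 := by rw [add_smul, one_smul, hJ]
    rcases smul_eq_zero.1 this with h | h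
    · nlinarith [mul_self_nonneg c]
    · exact h1D h
  have h1rad : (1 : T) ∈ radical hb.comm := fun u => by
    have := hb.comm_mul_right u 1 1
    simpa using this
  -- `J` is not real, so a basis element other than `1` occurs in it
  obtain ⟨f, hf1, hfr⟩ : ∃ f : T, f ≠ 1 ∧ b.repr J f ≠ 0 := by
    by_contra! h
    apply hreal (b.repr J 1)
    apply b.repr.injective
    ext t
    by_cases ht : t = 1
    · subst ht
      rw [← hb.one]
      simp
    · rw [h t ht, ← hb.one]
      simp [Ne.symm ht]
  have hfrad := hb.mem_radical_of_central hJc hfr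
  have hnot : ∀ t ∈ radical hb.comm, t ≠ 1 → ∃ r s : ℝ, s ≠ 0 ∧ b t = r • (1 : D) + s • J := by
    intro t ht ht1
    obtain ⟨r, s, h⟩ := hgen (b t) (hb.mul_eq_mul_of_mem_radical ht)
    refine ⟨r, s, ?_, h⟩
    rintro rfl
    rw [zero_smul, add_zero, ← hb.one] at h
    have := congrArg (fun x => b.repr x t) h
    simp [Ne.symm ht1] at this
  obtain ⟨r, s, hs, hbf⟩ := hnot f hfrad hf1
  -- a third element of the radical would give three independent elements of the center
  have hrad : radical hb.comm = {1, f} := by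
    ext t
    simp only [Set.mem_insert_iff, Set.mem_singleton_iff]
    constructor
    · intro ht
      by_contra! hne
      obtain ⟨r', s', hs', hbt⟩ := hnot t ht hne.1
      have : s • b t = (s * r' - s' * r) • b 1 + s' • b f := by
        rw [hb.one, hbt, hbf]
        module
      have := congrArg (fun x => b.repr x t) this
      simp [Ne.symm hne.1, Ne.symm hne.2, hs] at this
    · rintro (rfl | rfl)
      exacts [h1rad, hfrad]
  have hff : f * f = 1 := by
    have : f * f ∈ radical hb.comm := fun u => by rw [hb.comm_mul_right, hfrad u, one_mul]
    rw [hrad] at this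
    rcases this with h | h
    · exact h
    · exact absurd (mul_eq_left.1 h) hf1
  refine ⟨f, hf1, hrad, hff, (hb.cocycle f f : ℝ), ?_, ?_⟩
  · have h := hb.mul f f
    rw [hff, hb.one, hbf] at h
    -- `b f = r + s J` has a real square, so `r = 0` and the square is `-s²`
    have h2 : (2 * r * s) • J = ((hb.cocycle f f : ℝ) - (r * r - s * s)) • (1 : D) := by
      have : (r • (1 : D) + s • J) * (r • (1 : D) + s • J)
          = (r * r) • (1 : D) + (2 * r * s) • J + (s * s) • (J * J) := by
        simp only [add_mul, mul_add, smul_mul_smul_comm, one_mul, mul_one]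
        module
      rw [this, hJ] at h
      rw [sub_smul, ← h]
      module
    have h3 : 2 * r * s = 0 := by
      by_contra h0
      apply hreal ((2 * r * s)⁻¹ * ((hb.cocycle f f : ℝ) - (r * r - s * s)))
      rw [mul_smul, ← h2, smul_smul, inv_mul_cancel₀ h0, one_smul]
    have hr : r = 0 := by simpa [hs] using h3
    rw [h3, zero_smul] at h2
    have h4 : (hb.cocycle f f : ℝ) - (r * r - s * s) = 0 :=
      (smul_eq_zero.1 h2.symm).resolve_right h1D
    rw [hr] at h4
    have : 0 < s * s := mul_self_pos.2 hs
    linarith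
  · rw [hb.mul, hff, hb.one]

/-! ### Splitting of symmetric cocycles -/

lemma exists_zmodHom {E : Type*} [CommGroup E] (n : ℕ) [NeZero n] (e : E) (he : e ^ n = 1) :
    ∃ φ : Multiplicative (ZMod n) →* E, ∀ x, φ x = e ^ (Multiplicative.toAdd x).val := by
  let f : ℤ →+ Additive E := zmultiplesHom (Additive E) (Additive.ofMul e)
  have hf : f n = 0 := by
    simp only [f, zmultiplesHom_apply, natCast_zsmul]
    rw [← ofMul_pow, he, ofMul_one]
  refine ⟨AddMonoidHom.toMultiplicativeLeft (ZMod.lift n ⟨f, hf⟩), fun x => ?_⟩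
  have h := ZMod.lift_coe n ⟨f, hf⟩ ((Multiplicative.toAdd x).val : ℤ)
  rw [Int.cast_natCast, ZMod.natCast_zmod_val] at h
  change Additive.toMul ((ZMod.lift n ⟨f, hf⟩) (Multiplicative.toAdd x)) = _
  rw [h]
  simp only [f, zmultiplesHom_apply, natCast_zsmul]
  rfl

/-- A homomorphism onto a finite abelian group splits as soon as every element lifts to an element
of the same order: decompose the group into cyclic factors and lift their generators. -/
lemma exists_section {E T : Type*} [CommGroup E] [CommGroup T] [Finite T] (π : E →* T)
    (h : ∀ t, ∃ e, π e = t ∧ e ^ orderOf t = 1) : ∃ s : T →* E, ∀ t, π (s t) = t := by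
  classical
  obtain ⟨ι, _, n, hn, ⟨iso⟩⟩ := CommGroup.equiv_prod_multiplicative_zmod_of_finite T
  let g : ι → T := fun i => iso.symm (Pi.mulSingle i (Multiplicative.ofAdd 1))
  have hg : ∀ i, g i ^ n i = 1 := fun i => by
    simp only [g]
    rw [← map_pow, ← Pi.mulSingle_pow, ← ofAdd_nsmul]
    simp
  have : ∀ i, NeZero (n i) := fun i => ⟨by have := hn i; omega⟩
  have hlift : ∀ i, ∃ φ : Multiplicative (ZMod (n i)) →* E,
      ∀ x, π (φ x) = g i ^ (Multiplicative.toAdd x).val := by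
    intro i
    obtain ⟨e, he, ho⟩ := h (g i)
    obtain ⟨φ, hφ⟩ := exists_zmodHom (n i) e (by
      obtain ⟨k, hk⟩ := orderOf_dvd_of_pow_eq_one (hg i)
      rw [hk, pow_mul, ho, one_pow])
    exact ⟨φ, fun x => by rw [hφ, map_pow, he]⟩
  choose φ hφ using hlift
  let s : ((i : ι) → Multiplicative (ZMod (n i))) →* E :=
    ∏ i, (φ i).comp (Pi.evalMonoidHom _ i)
  have hs : π.comp s = iso.symm.toMonoidHom := by
    refine MonoidHom.pi_ext fun i x => ?_
    have hsi : s (Pi.mulSingle i x) = φ i x := by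
      simp only [s, MonoidHom.finsetProd_apply, MonoidHom.comp_apply, Pi.evalMonoidHom_apply]
      rw [Finset.prod_eq_single i]
      · simp
      · intro j _ hj
        simp [Pi.mulSingle_eq_of_ne hj]
      · simp
    rw [MonoidHom.comp_apply, hsi, hφ]
    simp only [g]
    rw [← map_pow, ← Pi.mulSingle_pow, ← ofAdd_nsmul, nsmul_one, ZMod.natCast_zmod_val]
    rfl
  refine ⟨s.comp iso.toMonoidHom, fun t => ?_⟩
  have := DFunLike.congr_fun hs (iso t)
  simpa using this

/-- The extension of `T` by `A` defined by a cocycle `τ`: the set `A × T` with the product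
`(a, u) (c, v) = (a c τ(u, v), u v)`. -/
@[ext]
structure CocycleExt {A T : Type*} (τ : T → T → A) where
  coeff : A
  deg : T

/-- The group structure of the extension defined by a normalised symmetric cocycle. -/
abbrev CocycleExt.commGroup {A T : Type*} [CommGroup A] [CommGroup T] (τ : T → T → A)
    (hsymm : ∀ u v, τ u v = τ v u)
    (hassoc : ∀ u v w, τ u v * τ (u * v) w = τ v w * τ u (v * w))
    (hone : ∀ v, τ 1 v = 1) : CommGroup (CocycleExt τ) where
  mul x y := ⟨x.1 * y.1 * τ x.2 y.2, x.2 * y.2⟩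
  one := ⟨1, 1⟩
  inv x := ⟨x.1⁻¹ * (τ x.2⁻¹ x.2)⁻¹, x.2⁻¹⟩
  mul_assoc x y z := by
    refine CocycleExt.ext ?_ (mul_assoc x.2 y.2 z.2)
    change (x.1 * y.1 * τ x.2 y.2) * z.1 * τ (x.2 * y.2) z.2
      = x.1 * (y.1 * z.1 * τ y.2 z.2) * τ x.2 (y.2 * z.2)
    have h := hassoc x.2 y.2 z.2
    calc _ = x.1 * y.1 * z.1 * (τ x.2 y.2 * τ (x.2 * y.2) z.2) := by ac_rfl
      _ = _ := by rw [h]; ac_rfl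
  one_mul x := by
    refine CocycleExt.ext ?_ (one_mul x.2)
    change 1 * x.1 * τ 1 x.2 = x.1
    rw [hone, one_mul, mul_one]
  mul_one x := by
    refine CocycleExt.ext ?_ (mul_one x.2)
    change x.1 * 1 * τ x.2 1 = x.1
    rw [hsymm, hone, mul_one, mul_one]
  inv_mul_cancel x := by
    refine CocycleExt.ext ?_ (inv_mul_cancel x.2)
    change (x.1⁻¹ * (τ x.2⁻¹ x.2)⁻¹) * x.1 * τ x.2⁻¹ x.2 = 1
    rw [mul_right_comm x.1⁻¹, inv_mul_cancel, one_mul, inv_mul_cancel]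
  mul_comm x y := by
    refine CocycleExt.ext ?_ (mul_comm x.2 y.2)
    change x.1 * y.1 * τ x.2 y.2 = y.1 * x.1 * τ y.2 x.2
    rw [hsymm, mul_comm x.1]

/-- On a group of exponent dividing `4`, a normalised symmetric cocycle is a coboundary if it is
trivial on the squares of involutions and its values `τ(t, t)²` are fourth powers. -/
lemma exists_cobounding {A T : Type*} [CommGroup A] [CommGroup T] [Finite T] (τ : T → T → A)
    (hsymm : ∀ u v, τ u v = τ v u)
    (hassoc : ∀ u v w, τ u v * τ (u * v) w = τ v w * τ u (v * w))
    (hone : ∀ v, τ 1 v = 1) (h4 : ∀ t : T, t ^ 4 = 1)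
    (hinv : ∀ t, t * t = 1 → τ t t = 1) (hlift : ∀ t, ∃ a : A, a ^ 4 * τ t t ^ 2 = 1) :
    ∃ s : T → A, ∀ u v, s (u * v) = s u * s v * τ u v := by
  let _ := CocycleExt.commGroup τ hsymm hassoc hone
  have hmul : ∀ x y : CocycleExt τ, x * y = ⟨x.1 * y.1 * τ x.2 y.2, x.2 * y.2⟩ :=
    fun _ _ => rfl
  let π : CocycleExt τ →* T :=
    { toFun := fun x => x.2, map_one' := rfl, map_mul' := fun _ _ => rfl }
  obtain ⟨s, hs⟩ := exists_section π (by
    intro t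
    obtain ⟨k, hk, ho⟩ := (Nat.dvd_prime_pow Nat.prime_two).1
      (show orderOf t ∣ 2 ^ 2 from orderOf_dvd_of_pow_eq_one (h4 t))
    interval_cases k
    · refine ⟨1, ?_, one_pow _⟩
      rw [map_one]
      exact (orderOf_eq_one_iff.1 (by simpa using ho)).symm
    · have ht : t * t = 1 := by
        rw [← pow_two, ← pow_one 2, ← ho, pow_orderOf_eq_one]
      refine ⟨⟨1, t⟩, rfl, ?_⟩
      rw [ho, pow_one, pow_two, hmul]
      refine CocycleExt.ext ?_ ht
      change 1 * 1 * τ t t = 1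
      rw [hinv t ht, one_mul, one_mul]
    · obtain ⟨a, ha⟩ := hlift t
      have ht : (t * t) * (t * t) = 1 := by
        rw [← h4 t]
        simp only [pow_succ, pow_zero, one_mul, mul_assoc]
      refine ⟨⟨a, t⟩, rfl, ?_⟩
      rw [ho, pow_two 2, pow_mul, pow_two, pow_two, hmul, hmul]
      refine CocycleExt.ext ?_ ht
      change (a * a * τ t t) * (a * a * τ t t) * τ (t * t) (t * t) = 1
      rw [hinv _ ht, mul_one, ← ha]
      simp only [pow_succ, pow_zero, one_mul]
      ac_rfl)
  have hs : ∀ t, (s t).2 = t := hs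
  -- the coefficients of a section form a cochain with coboundary `τ`
  refine ⟨fun t => (s t).1, fun u v => ?_⟩
  simp only [map_mul, hmul, hs]

/-! ### Isomorphisms of twisted group algebras -/

section Iso

variable {T D D' : Type*} [CommGroup T] [Ring D] [Algebra ℝ D] [Ring D'] [Algebra ℝ D']
  {b : Basis T ℝ D} {b' : Basis T ℝ D'}

/-- For groups of exponent dividing `4`, a real twisted group algebra is determined by its
commutation factor and by the squares of the basis elements whose degrees are involutions: the
quotient of the two cocycles is symmetric, and it is a coboundary by `exists_cobounding`. -/
lemma IsTwisted.exists_algEquiv [Finite T] (hb : IsTwisted b) (hb' : IsTwisted b')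
    (h4 : ∀ t : T, t ^ 4 = 1) (hcomm : ∀ u v, hb.comm u v = hb'.comm u v)
    (hsq : ∀ t, t * t = 1 → ∃ c : ℝ, b t * b t = c • (1 : D) ∧ b' t * b' t = c • (1 : D')) :
    ∃ φ : D ≃ₐ[ℝ] D', ∀ t, ∃ c : ℝˣ, φ (b t) = (c : ℝ) • b' t := by
  obtain ⟨s, hs⟩ := exists_cobounding (fun u v => hb.cocycle u v / hb'.cocycle u v)
    (fun u v => by
      have h := hcomm u v
      simp only [comm] at h
      rw [div_eq_div_iff_mul_eq_mul] at h ⊢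
      rw [h, mul_comm])
    (fun u v w => by
      rw [div_mul_div_comm, div_mul_div_comm, hb.cocycle_assoc, hb'.cocycle_assoc])
    (fun v => by rw [hb.cocycle_one_left, hb'.cocycle_one_left, div_one]) h4
    (fun t ht => by
      obtain ⟨c, h, h'⟩ := hsq t ht
      rw [hb.mul, ht, hb.one, ← hb.one] at h
      rw [hb'.mul, ht, hb'.one, ← hb'.one] at h'
      exact div_eq_one.2 (Units.ext ((smul_basis_inj h).trans (smul_basis_inj h').symm)))
    (fun t => by
      set x := hb.cocycle t t / hb'.cocycle t t
      have hpos : 0 < √|(x : ℝ)| := Real.sqrt_pos.2 (abs_pos.2 x.ne_zero)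
      refine ⟨(Units.mk0 _ hpos.ne')⁻¹, Units.ext ?_⟩
      rw [inv_pow, Units.val_mul, Units.val_inv_eq_inv_val, Units.val_pow_eq_pow_val,
        Units.val_pow_eq_pow_val, Units.val_mk0, Units.val_one,
        show √|(x : ℝ)| ^ 4 = (√|(x : ℝ)| ^ 2) ^ 2 by ring, Real.sq_sqrt (abs_nonneg _), sq_abs]
      exact inv_mul_cancel₀ (pow_ne_zero _ x.ne_zero))
  -- the rescaled basis `w t • b' t` has the same structure constants as `b`
  let w : T → ℝˣ := fun t => (s t)⁻¹
  let l : D ≃ₗ[ℝ] D' := b.equiv (b'.unitsSMul w) (Equiv.refl T)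
  have hl : ∀ t, l (b t) = (w t : ℝ) • b' t := fun t => by
    simp [l, Basis.unitsSMul_apply, Units.smul_def]
  have hw1 : w 1 = 1 := by
    have := hs 1 1
    rw [hb.cocycle_one_left, hb'.cocycle_one_left, div_one, mul_one, mul_one] at this
    simpa [w] using this
  have hl1 : l 1 = 1 := by rw [← hb.one, hl, hw1, hb'.one, Units.val_one, one_smul]
  have hmul : (LinearMap.mul ℝ D).compr₂ l.toLinearMap
      = (LinearMap.mul ℝ D').compl₁₂ l.toLinearMap l.toLinearMap := by
    refine b.ext fun u => b.ext fun v => ?_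
    simp only [LinearMap.compr₂_apply, LinearMap.compl₁₂_apply, LinearMap.mul_apply',
      LinearEquiv.coe_coe, hb.mul, map_smul, hl]
    rw [LinearMap.smul_apply, LinearMap.mul_apply', hb'.mul]
    simp only [smul_smul, ← Units.val_mul]
    congr 2
    simp only [w, hs]
    rw [mul_inv, mul_inv, inv_div, mul_left_comm, mul_div_cancel, mul_comm (s u)⁻¹,
      mul_assoc]
  refine ⟨AlgEquiv.ofLinearEquiv l hl1 fun x y => LinearMap.congr_fun₂ hmul x y,
    fun t => ⟨w t, hl t⟩⟩

end Iso

section Transport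

variable {T T' D D' : Type*} [CommGroup T] [CommGroup T'] [Ring D] [Algebra ℝ D] [Ring D']
  [Algebra ℝ D'] {b : Basis T ℝ D}

lemma IsTwisted.reindex (hb : IsTwisted b) (α : T ≃* T') : IsTwisted (b.reindex α.toEquiv) where
  one := by simpa using hb.one
  exists_mul u v := by
    obtain ⟨c, hc⟩ := hb.exists_mul (α.symm u) (α.symm v)
    exact ⟨c, by simpa using hc⟩

lemma IsTwisted.comm_reindex (hb : IsTwisted b) (α : T ≃* T') (u v : T') :
    (hb.reindex α).comm u v = hb.comm (α.symm u) (α.symm v) := by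
  refine (Units.ext ((hb.reindex α).comm_unique ?_)).symm
  simpa using hb.mul_comm_eq (α.symm u) (α.symm v)

lemma IsTwisted.map (hb : IsTwisted b) (φ : D ≃ₐ[ℝ] D') : IsTwisted (b.map φ.toLinearEquiv) where
  one := by simp [hb.one]
  exists_mul u v := by
    obtain ⟨c, hc⟩ := hb.exists_mul u v
    refine ⟨c, ?_⟩
    simp only [Basis.map_apply, AlgEquiv.toLinearEquiv_apply, ← map_mul, hc, map_smul]

lemma IsTwisted.comm_map (hb : IsTwisted b) (φ : D ≃ₐ[ℝ] D') (u v : T) :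
    (hb.map φ).comm u v = hb.comm u v := by
  refine (Units.ext ((hb.map φ).comm_unique ?_)).symm
  simp only [Basis.map_apply, AlgEquiv.toLinearEquiv_apply, ← map_mul]
  rw [hb.mul_comm_eq, map_smul]

end Transport

section GradedIso

variable {G H D D' : Type*} [CommGroup G] [CommGroup H] [Ring D] [Algebra ℝ D] [Ring D']
  [Algebra ℝ D'] {Γ : Family G D} {Γ' : Family H D'} {T : Subgroup G} {T' : Subgroup H}
  {b : Basis T ℝ D} {b' : Basis T' ℝ D'}

/-- Gradings with the same invariants, up to an isomorphism of their supports, are related by an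
isomorphism of algebras. -/
lemma IsHomogeneousBasis.exists_algEquiv [Finite T] (hb : IsHomogeneousBasis Γ T b)
    (hb' : IsHomogeneousBasis Γ' T' b') (α : T ≃* T') (h4 : ∀ t : T, t ^ 4 = 1)
    (hcomm : ∀ u v, hb.toIsTwisted.comm u v = hb'.toIsTwisted.comm (α u) (α v))
    (hsq : ∀ t, t * t = 1 →
      ∃ c : ℝ, b t * b t = c • (1 : D) ∧ b' (α t) * b' (α t) = c • (1 : D')) :
    ∃ φ : D ≃ₐ[ℝ] D', ∀ t : T, (Γ t).map φ.toLinearMap = Γ' (α t) := by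
  obtain ⟨φ, hφ⟩ := hb.toIsTwisted.exists_algEquiv (hb'.toIsTwisted.reindex α.symm) h4
    (fun u v => by rw [hcomm, hb'.toIsTwisted.comm_reindex]; simp)
    (fun t ht => by simpa using hsq t ht)
  refine ⟨φ, fun t => ?_⟩
  obtain ⟨c, hc⟩ := hφ t
  rw [hb.eq_span, hb'.eq_span, Submodule.map_span, Set.image_singleton]
  rw [show φ.toLinearMap (b t) = (c : ℝ) • b' (α t) by simpa using hc]
  exact Submodule.span_singleton_smul_eq c.isUnit _

lemma IsHomogeneousBasis.isomorphic {Γ' : Family G D'} {b' : Basis T ℝ D'} [Finite T]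
    (hb : IsHomogeneousBasis Γ T b)
    (hb' : IsHomogeneousBasis Γ' T b') (h4 : ∀ t : T, t ^ 4 = 1)
    (hcomm : ∀ u v, hb.toIsTwisted.comm u v = hb'.toIsTwisted.comm u v)
    (hsq : ∀ t, t * t = 1 → ∃ c : ℝ, b t * b t = c • (1 : D) ∧ b' t * b' t = c • (1 : D')) :
    Isomorphic Γ Γ' := by
  obtain ⟨φ, hφ⟩ := hb.exists_algEquiv hb' (MulEquiv.refl T) h4 hcomm hsq
  refine ⟨φ, fun g => ?_⟩
  by_cases hg : g ∈ T
  · exact hφ ⟨g, hg⟩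
  · rw [hb.eq_bot g hg, hb'.eq_bot g hg, Submodule.map_bot]

lemma IsHomogeneousBasis.equivalent [Finite T] (hb : IsHomogeneousBasis Γ T b)
    (hb' : IsHomogeneousBasis Γ' T' b') (α : T ≃* T') (h4 : ∀ t : T, t ^ 4 = 1)
    (hcomm : ∀ u v, hb.toIsTwisted.comm u v = hb'.toIsTwisted.comm (α u) (α v))
    (hsq : ∀ t, t * t = 1 →
      ∃ c : ℝ, b t * b t = c • (1 : D) ∧ b' (α t) * b' (α t) = c • (1 : D')) :
    Equivalent Γ Γ' := by
  obtain ⟨φ, hφ⟩ := hb.exists_algEquiv hb' α h4 hcomm hsq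
  exact ⟨φ, ((Equiv.setCongr hb.support_eq.symm).trans α.toEquiv).trans
    (Equiv.setCongr hb'.support_eq), fun t => hφ ⟨t, by
      rw [← SetLike.mem_coe, hb.support_eq]; exact t.2⟩⟩

/-- The family of subspaces of `D` obtained from a basis indexed by a subgroup of `G`. -/
def familyOfBasis (T : Subgroup G) (b : Basis T ℝ D) : Family G D :=
  fun g => Submodule.span ℝ {x | ∃ t : T, (t : G) = g ∧ x = b t}

lemma isHomogeneousBasis_familyOfBasis (hb : IsTwisted b) :
    IsHomogeneousBasis (familyOfBasis T b) T b where
  toIsTwisted := hb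
  eq_span t := by
    rw [familyOfBasis]
    congr 1
    ext x
    constructor
    · rintro ⟨s, hs, rfl⟩
      rw [Subtype.ext hs]
      rfl
    · rintro rfl
      exact ⟨t, rfl, rfl⟩
  eq_bot g hg := by
    rw [familyOfBasis, Submodule.span_eq_bot]
    rintro x ⟨t, rfl, -⟩
    exact absurd t.2 hg

end GradedIso

/-! ### Hyperbolic planes -/

section Orthogonal

variable {T M : Type*} [CommGroup T] [CommGroup M]

/-- The elements orthogonal to `u` and to `v` with respect to a map `B` that is multiplicative in
the second variable. -/
def orthogonalPair (B : T → T → M) (hB : ∀ u v w, B u (v * w) = B u v * B u w) (u v : T) :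
    Subgroup T :=
  (MonoidHom.mk' (B u) (hB u)).ker ⊓ (MonoidHom.mk' (B v) (hB v)).ker

lemma mem_orthogonalPair {B : T → T → M} {hB : ∀ u v w, B u (v * w) = B u v * B u w} {u v t : T} :
    t ∈ orthogonalPair B hB u v ↔ B u t = 1 ∧ B v t = 1 := Iff.rfl

variable {B : T → T → M} (hB : ∀ u v w, B u (v * w) = B u v * B u w) {u v : T} {c : M}
  (huu : B u u = 1) (hvv : B v v = 1) (huv : B u v = c) (hvu : B v u = c) (hcc : c * c = 1)
  (hu : ∀ t, B u t = 1 ∨ B u t = c) (hv : ∀ t, B v t = 1 ∨ B v t = c)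

include huu hvv huv hvu hcc hu hv

/-- A hyperbolic pair and its orthogonal complement generate the group. -/
lemma exists_mem_orthogonalPair (t : T) :
    ∃ i j : ℕ, t * (u ^ i * v ^ j) ∈ orthogonalPair B hB u v := by
  simp only [mem_orthogonalPair]
  rcases hu t with h1 | h1 <;> rcases hv t with h2 | h2
  · exact ⟨0, 0, by simp [h1, h2]⟩
  · exact ⟨1, 0, by simp [h1, h2, hB, huu, hvu, hcc]⟩
  · exact ⟨0, 1, by simp [h1, h2, hB, hvv, huv, hcc]⟩
  · exact ⟨1, 1, by simp [h1, h2, hB, hvv, huv, huu, hvu, hcc]⟩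

/-- The radical of the orthogonal complement of a hyperbolic pair is the radical of the group. -/
lemma eq_one_of_orthogonal (hB' : ∀ u v w, B (u * v) w = B u w * B v w) {k : T}
    (hk : k ∈ orthogonalPair B hB u v) (h : ∀ l ∈ orthogonalPair B hB u v, B l k = 1) (t : T) :
    B t k = 1 := by
  obtain ⟨i, j, hij⟩ := exists_mem_orthogonalPair hB huu hvv huv hvu hcc hu hv t
  have hpow : ∀ (x : T) (i : ℕ), B x k = 1 → B (x ^ i) k = 1 := fun x i hx => by
    have := map_pow (MonoidHom.mk' (fun y => B y k) (fun y z => hB' y z k)) x i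
    simpa [hx] using this
  have := h _ hij
  rwa [hB', hB', hpow u i hk.1, hpow v j hk.2, mul_one, mul_one] at this

end Orthogonal

/-! ### Normal form of quadratic forms of type II -/

section NormalForm

/-- The exponents `0` and `1` of a group of order two, and `0, …, 3` of a cyclic group of order
four. -/
abbrev expo {n : ℕ} (x : Multiplicative (ZMod n)) : ℕ := (Multiplicative.toAdd x).val

/-- The signs of the squares of the homogeneous matrices in `M_2(ℝ)`: only `ab` has the sign
`-1`. -/
def planeForm (x : Z2 × Z2) : ℤˣ := (-1) ^ (expo x.1 * expo x.2)

/-- The quadratic form of the product grading on `M_2(ℝ) ⊗ ⋯ ⊗ M_2(ℝ)`. -/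
def planesForm (k : ℕ) (x : Fin k → Z2 × Z2) : ℤˣ := ∏ i, planeForm (x i)

/-- The quadratic form of the product grading on `M_2(ℝ) ⊗ ⋯ ⊗ M_2(ℝ) ⊗ ℂ`. -/
def formOne (k : ℕ) (x : (Fin k → Z2 × Z2) × Z2) : ℤˣ := planesForm k x.1 * (-1) ^ expo x.2

/-- Splitting off the first factor of a power. -/
def consSplit (k : ℕ) (A C : Type*) [CommGroup A] [CommGroup C] :
    (Fin (k + 1) → A) × C ≃* A × ((Fin k → A) × C) where
  toFun x := (x.1 0, (Fin.tail x.1, x.2))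
  invFun y := (Fin.cons y.1 y.2.1, y.2.2)
  left_inv x := by simp
  right_inv y := by simp
  map_mul' _ _ := rfl

lemma formOne_succ (k : ℕ) (x : (Fin (k + 1) → Z2 × Z2) × Z2) :
    formOne (k + 1) x
      = planeForm (consSplit k _ _ x).1 * formOne k (consSplit k _ _ x).2 := by
  simp only [formOne, planesForm, Fin.prod_univ_succ, mul_assoc]
  rfl

variable {T : Type*} [CommGroup T] {μ : T → ℤˣ}

lemma map_mul_eq_polar (μ : T → ℤˣ) (u v : T) : μ (u * v) = polar μ u v * (μ u * μ v) := by
  rw [polar, mul_mul_mul_comm, mul_assoc _ (μ u)⁻¹, inv_mul_cancel, mul_one, inv_mul_cancel,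
    mul_one]

lemma polar_comm (μ : T → ℤˣ) (u v : T) : polar μ u v = polar μ v u := by
  rw [polar, polar, mul_comm u, mul_right_comm]

lemma IsQuadraticForm.mul_self (hμ : IsQuadraticForm μ) (t : T) : t * t = 1 := by
  rw [← pow_two, hμ.elementary]

lemma IsQuadraticForm.polar_self (hμ : IsQuadraticForm μ) (t : T) : polar μ t t = 1 := by
  rw [polar, hμ.mul_self, hμ.map_one, one_mul, ← mul_inv, Int.units_mul_self, inv_one]

/-- Multiplication by the radical element `f` with `μ f = -1` changes the sign of the form but not
the pairings, so any element can be made to have the value `1`. -/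
lemma IsQuadraticForm.exists_adjust (hμ : IsQuadraticForm μ) {f : T} (hf : μ f = -1)
    (hr : f ∈ radical (polar μ)) (u : T) :
    ∃ u', μ u' = 1 ∧ ∀ w, polar μ w u' = polar μ w u := by
  rcases Int.units_eq_one_or (μ u) with h | h
  · exact ⟨u, h, fun _ => rfl⟩
  · refine ⟨u * f, ?_, fun w => by rw [hμ.polar_mul_right, hr w, mul_one]⟩
    rw [map_mul_eq_polar μ, hr u, hf, h]
    rfl

lemma planeForm_cases (i j : Z2) :
    (i = 1 ∧ j = 1 ∨ i = 1 ∧ j = Multiplicative.ofAdd 1 ∨ i = Multiplicative.ofAdd 1 ∧ j = 1 ∨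
      i = Multiplicative.ofAdd 1 ∧ j = Multiplicative.ofAdd 1) := by
  revert i j
  decide

/-- Quadratic forms of type II have the normal form `formOne`: they split off hyperbolic planes until
only the radical is left. -/
theorem IsQuadraticForm.exists_normalForm {T : Type*} [CommGroup T] [Finite T] {μ : T → ℤˣ}
    (hμ : IsQuadraticForm μ) {f : T} (hf : μ f = -1) (hr : radical (polar μ) = {1, f}) :
    ∃ (k : ℕ) (ψ : (Fin k → Z2 × Z2) × Z2 ≃* T),
      (∀ x, μ (ψ x) = formOne k x) ∧ ψ (1, Multiplicative.ofAdd 1) = f := by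
  induction hN : Nat.card T using Nat.strong_induction_on generalizing T with
  | _ N ih =>
  have hfr : f ∈ radical (polar μ) := by rw [hr]; simp
  have hf1 : f ≠ 1 := by
    rintro rfl
    rw [hμ.map_one] at hf
    exact absurd hf (by decide)
  by_cases hall : ∀ t, t ∈ radical (polar μ)
  · obtain ⟨φ, hφ⟩ := exists_zmodHom 2 f (hμ.elementary f)
    let ψ : (Fin 0 → Z2 × Z2) × Z2 →* T := φ.comp (MonoidHom.snd _ _)
    have h0 : ∀ x, ψ (x, 1) = 1 := fun x => by simp [ψ]
    have h1 : ∀ x, ψ (x, Multiplicative.ofAdd 1) = f := fun x => by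
      simp only [ψ, MonoidHom.comp_apply, MonoidHom.coe_snd, hφ]
      exact pow_one f
    have hz : ∀ z : Z2, z = 1 ∨ z = Multiplicative.ofAdd 1 := by decide
    have hbij : Function.Bijective ψ := by
      constructor
      · refine (injective_iff_map_eq_one ψ).2 ?_
        rintro ⟨x, z⟩ hx
        rcases hz z with rfl | rfl
        · exact Prod.ext (Subsingleton.elim _ _) rfl
        · rw [h1] at hx
          exact absurd hx hf1
      · intro t
        have := hall t
        rw [hr] at this
        rcases this with rfl | rfl
        · exact ⟨1, _root_.map_one ψ⟩
        · exact ⟨(1, Multiplicative.ofAdd 1), h1 1⟩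
    refine ⟨0, MulEquiv.ofBijective ψ hbij, ?_, h1 1⟩
    rintro ⟨x, z⟩
    rw [MulEquiv.ofBijective_apply]
    rcases hz z with rfl | rfl
    · rw [h0, hμ.map_one]
      rfl
    · rw [h1, hf]
      rfl
  · -- a hyperbolic pair `u, v` with `μ u = μ v = 1`
    push Not at hall
    obtain ⟨u₀, hu₀⟩ := hall
    simp only [radical, Set.mem_ofPred_eq, not_forall] at hu₀
    obtain ⟨v₀, hv₀⟩ := hu₀
    obtain ⟨u, hμu, hu⟩ := hμ.exists_adjust hf hfr u₀
    obtain ⟨v, hμv, hv⟩ := hμ.exists_adjust hf hfr v₀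
    have hvu : polar μ v u = -1 := by
      rw [hu, polar_comm, hv, polar_comm]
      exact (Int.units_eq_one_or _).resolve_left hv₀
    have huv : polar μ u v = -1 := by rw [polar_comm, hvu]
    let K := orthogonalPair (polar μ) hμ.polar_mul_right u v
    have hdec := exists_mem_orthogonalPair hμ.polar_mul_right (hμ.polar_self u) (hμ.polar_self v)
      huv hvu (by decide) (fun t => Int.units_eq_one_or _) (fun t => Int.units_eq_one_or _)
    have hradK := @eq_one_of_orthogonal _ _ _ _ _ hμ.polar_mul_right _ _ _ (hμ.polar_self u)
      (hμ.polar_self v) huv hvu (by decide) (fun t => Int.units_eq_one_or _)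
      (fun t => Int.units_eq_one_or _) hμ.polar_mul_left
    have hfK : f ∈ K := ⟨hfr u, hfr v⟩
    have hμK : IsQuadraticForm (fun k : K => μ k) :=
      { elementary := fun t => Subtype.ext (hμ.elementary t)
        map_one := hμ.map_one
        polar_mul_left := fun a b c => hμ.polar_mul_left a b c
        polar_mul_right := fun a b c => hμ.polar_mul_right a b c }
    have hrK : radical (polar fun k : K => μ k) = {1, ⟨f, hfK⟩} := by
      ext k
      constructor
      · intro hk
        have : (k : T) ∈ radical (polar μ) := hradK k.2 fun l hl => hk ⟨l, hl⟩
        rw [hr] at this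
        rcases this with h | h
        · exact Or.inl (Subtype.ext h)
        · exact Or.inr (Subtype.ext h)
      · rintro (rfl | rfl)
        · intro l
          have := hμ.polar_mul_right l 1 1
          rw [mul_one] at this
          exact left_eq_mul.1 this
        · exact fun l => hfr l
    have huK : u ∉ K := fun h => by
      have := h.2
      change polar μ v u = 1 at this
      rw [hvu] at this
      exact absurd this (by decide)
    obtain ⟨k, ψ, hψ, hψf⟩ := ih (Nat.card K) (by
      rw [← hN]
      exact Finite.card_subtype_lt huK) hμK hf hrK rfl
    obtain ⟨φu, hφu⟩ := exists_zmodHom 2 u (hμ.elementary u)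
    obtain ⟨φv, hφv⟩ := exists_zmodHom 2 v (hμ.elementary v)
    have hpow : ∀ (w t : T) (i : ℕ), polar μ w (t ^ i) = polar μ w t ^ i := fun w t i =>
      map_pow (MonoidHom.mk' (polar μ w) (hμ.polar_mul_right w)) t i
    let Φ : (Z2 × Z2) × K →* T := (φu.coprod φv).coprod K.subtype
    have hΦ : ∀ x, Φ x = u ^ expo x.1.1 * v ^ expo x.1.2 * x.2 := fun x => by
      simp [Φ, hφu, hφv]
    have hexpo : ∀ i : Z2, (-1 : ℤˣ) ^ expo i = 1 → i = 1 := by decide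
    have hbij : Function.Bijective Φ := by
      constructor
      · refine (injective_iff_map_eq_one Φ).2 ?_
        rintro ⟨⟨i, j⟩, k⟩ h
        rw [hΦ] at h
        have h1 : ∀ w, polar μ w 1 = 1 := fun w => by
          have := hμ.polar_mul_right w 1 1
          simpa using this
        have hj := congrArg (polar μ u) h
        rw [hμ.polar_mul_right, hμ.polar_mul_right, hpow, hpow, hμ.polar_self, huv, h1,
          show polar μ u k = 1 from k.2.1, one_pow, one_mul, mul_one] at hj
        have hi := congrArg (polar μ v) h
        rw [hμ.polar_mul_right, hμ.polar_mul_right, hpow, hpow, hμ.polar_self, hvu, h1,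
          show polar μ v k = 1 from k.2.2, one_pow, mul_one, mul_one] at hi
        obtain rfl := hexpo i hi
        obtain rfl := hexpo j hj
        have : (k : T) = 1 := by
          change u ^ 0 * v ^ 0 * (k : T) = 1 at h
          rwa [pow_zero, pow_zero, one_mul, one_mul] at h
        rw [Prod.mk_eq_one]
        exact ⟨rfl, Subtype.ext this⟩
      · intro t
        obtain ⟨i, j, hij⟩ := hdec t
        refine ⟨(((Multiplicative.ofAdd (1 : ZMod 2)) ^ i, (Multiplicative.ofAdd (1 : ZMod 2)) ^ j),
          ⟨_, hij⟩), ?_⟩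
        have e1 : ∀ (φ : Z2 →* T) (w : T) (_ : ∀ x, φ x = w ^ expo x) (i : ℕ),
            φ (Multiplicative.ofAdd (1 : ZMod 2) ^ i) = w ^ i := fun φ w h i => by
          rw [map_pow, h]
          exact congrArg (· ^ i) (pow_one w)
        simp only [Φ, MonoidHom.coprod_apply, e1 φu u hφu, e1 φv v hφv, Subgroup.coe_subtype]
        rw [mul_left_comm, ← pow_two, hμ.elementary, mul_one]
    have hμΦ : ∀ x, μ (Φ x) = planeForm x.1 * μ x.2 := by
      rintro ⟨⟨i, j⟩, k⟩
      have hk : polar μ (u ^ expo i * v ^ expo j) k = 1 := by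
        rw [polar_comm, hμ.polar_mul_right, hpow, hpow, polar_comm, show polar μ u k = 1 from k.2.1,
          polar_comm, show polar μ v k = 1 from k.2.2, one_pow, one_pow, one_mul]
      rw [hΦ, map_mul_eq_polar μ, hk, one_mul]
      congr 1
      have e1 : ∀ w : T, w ^ expo (1 : Z2) = 1 := fun w => pow_zero w
      have e2 : ∀ w : T, w ^ expo (Multiplicative.ofAdd (1 : ZMod 2)) = w := fun w => pow_one w
      rcases planeForm_cases i j with ⟨rfl, rfl⟩ | ⟨rfl, rfl⟩ | ⟨rfl, rfl⟩ | ⟨rfl, rfl⟩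
      · simp only [e1, mul_one, hμ.map_one]
        rfl
      · simp only [e1, e2, one_mul, hμv]
        rfl
      · simp only [e1, e2, mul_one, hμu]
        rfl
      · simp only [e2]
        rw [map_mul_eq_polar μ, huv, hμu, hμv]
        rfl
    refine ⟨k + 1, (consSplit k _ _).trans (((MulEquiv.refl _).prodCongr ψ).trans
      (MulEquiv.ofBijective Φ hbij)), fun x => ?_, ?_⟩
    · rw [formOne_succ, ← hψ]
      exact hμΦ _
    · change Φ (1, ψ (1, Multiplicative.ofAdd 1)) = f
      rw [hψf]
      simp [Φ]

end NormalForm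

/-! ### Normal form in the presence of elements of order four -/

section Duality

variable {T : Type*} [CommGroup T] {β : T → T → ℝˣ}

lemma IsAlternatingBicharacter.one_right (hβ : IsAlternatingBicharacter β) (u : T) : β u 1 = 1 := by
  simpa using hβ.mul_right u 1 1

lemma IsAlternatingBicharacter.symm (hβ : IsAlternatingBicharacter β) (u v : T) :
    β u v * β v u = 1 := by
  have h := hβ.self_eq_one (u * v)
  rwa [hβ.mul_left, hβ.mul_right, hβ.mul_right, hβ.self_eq_one, hβ.self_eq_one, one_mul, mul_one]
    at h

lemma IsAlternatingBicharacter.pow_right (hβ : IsAlternatingBicharacter β) (u v : T) (n : ℕ) :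
    β u (v ^ n) = β u v ^ n :=
  map_pow (MonoidHom.mk' (β u) (hβ.mul_right u)) v n

lemma IsAlternatingBicharacter.pow_left (hβ : IsAlternatingBicharacter β) (u v : T) (n : ℕ) :
    β (u ^ n) v = β u v ^ n :=
  map_pow (MonoidHom.mk' (fun u => β u v) (fun x y => hβ.mul_left x y v)) u n

/-- A real number of finite order is `1` or `-1`. -/
lemma IsAlternatingBicharacter.eq_one_or [Finite T] (hβ : IsAlternatingBicharacter β) (u v : T) :
    β u v = 1 ∨ β u v = -1 := by
  have h : β u v ^ Nat.card T = 1 := by rw [← hβ.pow_right, pow_card_eq_one', hβ.one_right]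
  have h2 : |((β u v : ℝˣ) : ℝ)| = 1 := by
    refine (pow_eq_one_iff_of_nonneg (abs_nonneg _) (Nat.card_pos (α := T)).ne').1 ?_
    rw [← abs_pow, ← Units.val_pow_eq_pow_val, h, Units.val_one, abs_one]
  rcases eq_or_eq_neg_of_abs_eq h2 with h3 | h3
  · exact Or.inl (Units.ext h3)
  · exact Or.inr (Units.ext h3)

/-- Squares lie in the radical, because real bicharacters of finite groups have values `±1`. -/
lemma IsAlternatingBicharacter.mul_self_mem_radical [Finite T] (hβ : IsAlternatingBicharacter β)
    (t : T) : t * t ∈ radical β := fun u => by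
  rw [hβ.mul_right]
  rcases hβ.eq_one_or u t with h | h <;> simp [h]

/-- A bicharacter with radical `{1, f}` realises every complex character that is trivial on `f`:
both kinds of characters make up half of the dual group. -/
lemma IsAlternatingBicharacter.exists_eq_character [Finite T] (hβ : IsAlternatingBicharacter β)
    {f : T} (hf1 : f ≠ 1) (hr : radical β = {1, f}) (χ : T →* ℂˣ) (hχ : χ f = 1) :
    ∃ a : T, ∀ t, χ t = Units.map (algebraMap ℝ ℂ).toMonoidHom (β a t) := by
  let ι : ℝˣ →* ℂˣ := Units.map (algebraMap ℝ ℂ).toMonoidHom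
  have hι : Function.Injective ι := Units.map_injective (algebraMap ℝ ℂ).injective
  let B : T →* (T →* ℂˣ) := MonoidHom.mk'
    (fun a => ι.comp (MonoidHom.mk' (β a) (hβ.mul_right a)))
    (fun a b => MonoidHom.ext fun t => by
      change ι (β (a * b) t) = ι (β a t) * ι (β b t)
      rw [hβ.mul_left, map_mul])
  have hker : (B.ker : Set T) = {1, f} := by
    rw [← hr]
    ext t
    have hs : ∀ u, β u t = 1 ↔ β t u = 1 := fun u => by
      have h := hβ.symm u t
      constructor <;> intro h' <;> simpa [h'] using h
    simp only [SetLike.mem_coe, MonoidHom.mem_ker, radical, Set.mem_ofPred_eq, hs]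
    constructor
    · intro h u
      exact hι ((DFunLike.congr_fun h u).trans (map_one ι).symm)
    · intro h
      refine MonoidHom.ext fun u => ?_
      change ι (β t u) = 1
      rw [h u, map_one]
  have hcard : Nat.card B.ker = 2 := by
    rw [← SetLike.coe_sort_coe, hker, Nat.card_coe_set_eq, Set.ncard_pair (Ne.symm hf1)]
  have : Finite (T →* ℂˣ) := inferInstance
  have hTdual : Nat.card (T →* ℂˣ) = Nat.card T :=
    CommGroup.card_monoidHom_of_hasEnoughRootsOfUnity T ℂ
  have hrange : 2 * Nat.card B.range = Nat.card (T →* ℂˣ) := by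
    rw [hTdual, ← hcard, mul_comm, Subgroup.card_eq_card_quotient_mul_card_subgroup B.ker]
    congr 1
    exact Nat.card_congr (QuotientGroup.quotientKerEquivRange B).symm.toEquiv
  let ev : (T →* ℂˣ) →* ℂˣ := MonoidHom.mk' (fun χ => χ f) (fun _ _ => rfl)
  have hle : B.range ≤ ev.ker := by
    rintro _ ⟨a, rfl⟩
    have : f ∈ radical β := by rw [hr]; simp
    change ι (β a f) = 1
    rw [this a, map_one]
  have hlt : ev.ker ≠ ⊤ := by
    intro h
    obtain ⟨φ, hφ⟩ := CommGroup.exists_apply_ne_one_of_hasEnoughRootsOfUnity T ℂ hf1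
    exact hφ (h ▸ Subgroup.mem_top φ : φ ∈ ev.ker)
  have heq : B.range = ev.ker := by
    refine Subgroup.eq_of_le_of_card_ge hle ?_
    have h1 := Subgroup.card_mul_index ev.ker
    have h2 : 2 ≤ ev.ker.index := by
      have h0 : ev.ker.index ≠ 0 := Subgroup.FiniteIndex.index_ne_zero
      have h1 : ev.ker.index ≠ 1 := fun h => hlt (Subgroup.index_eq_one.1 h)
      omega
    nlinarith
  have : χ ∈ B.range := heq ▸ hχ
  obtain ⟨a, rfl⟩ := this
  exact ⟨a, fun t => rfl⟩

end Duality

section NormalForm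

/-- The signs of the squares of the homogeneous matrices in `M_2(ℂ)` of degrees `a^i b^j` with `j`
even: the sign is `1` for `j = 0` and `-1` for `j = 2`. The value at odd `j` is irrelevant. -/
def cyclicForm (x : Z2 × Z4) : ℤˣ := (-1) ^ (expo x.2 / 2)

/-- The commutation factor of the grading on `M_2(ℂ)`. -/
def cyclicBichar (x y : Z2 × Z4) : ℤˣ := (-1) ^ (expo x.1 * expo y.2 + expo x.2 * expo y.1)

/-- The quadratic form of the product grading on `M_2(ℝ) ⊗ ⋯ ⊗ M_2(ℝ) ⊗ M_2(ℂ)`, defined on all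
degrees but meaningful at involutions. -/
def formTwo (k : ℕ) (x : (Fin k → Z2 × Z2) × (Z2 × Z4)) : ℤˣ := planesForm k x.1 * cyclicForm x.2

/-- The commutation factor of the product grading on `M_2(ℝ) ⊗ ⋯ ⊗ M_2(ℝ) ⊗ M_2(ℂ)`. -/
def bicharTwo (k : ℕ) (x y : (Fin k → Z2 × Z2) × (Z2 × Z4)) : ℤˣ :=
  polar (planesForm k) x.1 y.1 * cyclicBichar x.2 y.2

lemma mem_twoTorsion {T : Type*} [CommGroup T] {t : T} : t ∈ twoTorsion T ↔ t * t = 1 := by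
  rw [← pow_two]
  rfl

/-- The normal form of the data `(β, μ)` on a group with elements of order four. The element `a` is
chosen such that `β(a, ·)` detects the elements of order four; then the orthogonal complement of
`a` and of any `b` with `b² = f` is elementary, and its quadratic form has type II. -/
theorem exists_normalForm_bicharacter {T : Type*} [CommGroup T] [Finite T] {β : T → T → ℝˣ}
    (hβ : IsAlternatingBicharacter β) {f b : T} (hf1 : f ≠ 1) (hr : radical β = {1, f})
    (hb : b * b = f) {μ : twoTorsion T → ℤˣ} (hμ : IsQuadraticForm μ)
    (hres : ∀ u v : twoTorsion T, ((β u v : ℝˣ) : ℝ) = ((polar μ u v : ℤˣ) : ℤ))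
    (hfμ : ∃ h : f ∈ twoTorsion T, μ ⟨f, h⟩ = -1) :
    ∃ (k : ℕ) (ψ : (Fin k → Z2 × Z2) × (Z2 × Z4) ≃* T),
      (∀ x y, ((β (ψ x) (ψ y) : ℝˣ) : ℝ) = ((bicharTwo k x y : ℤˣ) : ℤ)) ∧
      ∀ x (h : ψ x ∈ twoTorsion T), μ ⟨ψ x, h⟩ = formTwo k x := by
  obtain ⟨hfT, hfμ⟩ := hfμ
  have hff : f * f = 1 := mem_twoTorsion.1 hfT
  have hfr : f ∈ radical β := by rw [hr]; simp
  have hfl : ∀ u, β f u = 1 := fun u => by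
    have := hβ.symm f u
    rwa [hfr u, mul_one] at this
  have hsq : ∀ t : T, t * t = 1 ∨ t * t = f := fun t => by
    have := hβ.mul_self_mem_radical t
    rwa [hr] at this
  -- the character that detects the elements of order four
  classical
  have hχmul : ∀ s t : T, (if (s * t) * (s * t) = 1 then (1 : ℂˣ) else -1)
      = (if s * s = 1 then 1 else -1) * (if t * t = 1 then 1 else -1) := fun s t => by
    rw [mul_mul_mul_comm]
    rcases hsq s with h1 | h1 <;> rcases hsq t with h2 | h2 <;> simp [h1, h2, hf1, hff]
  obtain ⟨a₀, ha₀⟩ := hβ.exists_eq_character hf1 hr (MonoidHom.mk'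
    (fun t : T => if t * t = 1 then (1 : ℂˣ) else -1) hχmul) (by simp [hff])
  have ha₀ : ∀ t, β a₀ t = if t * t = 1 then 1 else -1 := fun t => by
    apply Units.map_injective (algebraMap ℝ ℂ).injective
    refine (ha₀ t).symm.trans ?_
    simp only [MonoidHom.mk'_apply]
    split_ifs
    · rw [map_one]
    · ext
      simp
  obtain ⟨a, haT, hμa, ha⟩ : ∃ a, ∃ h : a ∈ twoTorsion T, μ ⟨a, h⟩ = 1 ∧
      ∀ t, β a t = if t * t = 1 then 1 else -1 := by
    have h0 : a₀ * a₀ = 1 := by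
      have h1 := ha₀ a₀
      rw [hβ.self_eq_one] at h1
      by_contra h
      rw [if_neg h] at h1
      have := congrArg Units.val h1
      norm_num at this
    rcases Int.units_eq_one_or (μ ⟨a₀, mem_twoTorsion.2 h0⟩) with h | h
    · exact ⟨a₀, _, h, ha₀⟩
    · refine ⟨a₀ * f, mul_mem (mem_twoTorsion.2 h0) hfT, ?_, fun t => by
        rw [hβ.mul_left, hfl, mul_one, ha₀]⟩
      have hp : polar μ ⟨a₀, mem_twoTorsion.2 h0⟩ ⟨f, hfT⟩ = 1 := by
        have h1 := hres ⟨a₀, mem_twoTorsion.2 h0⟩ ⟨f, hfT⟩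
        rw [hfr a₀] at h1
        rcases Int.units_eq_one_or (polar μ ⟨a₀, mem_twoTorsion.2 h0⟩ ⟨f, hfT⟩) with h2 | h2
        · exact h2
        · rw [h2] at h1
          norm_num at h1
      have := map_mul_eq_polar μ ⟨a₀, mem_twoTorsion.2 h0⟩ ⟨f, hfT⟩
      rw [hp, h, hfμ] at this
      exact this.trans (by decide)
  have haa : a * a = 1 := mem_twoTorsion.1 haT
  have hab : β a b = -1 := by rw [ha, hb, if_neg hf1]
  have hba : β b a = -1 := by
    have := hβ.symm b a
    rw [hab] at this
    rcases hβ.eq_one_or b a with h | h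
    · rw [h] at this
      have := congrArg Units.val this
      norm_num at this
    · exact h
  let K := orthogonalPair β hβ.mul_right a b
  have hdec := exists_mem_orthogonalPair hβ.mul_right (hβ.self_eq_one a) (hβ.self_eq_one b)
    hab hba (by simp) (fun t => hβ.eq_one_or _ _) (fun t => hβ.eq_one_or _ _)
  have hradK := @eq_one_of_orthogonal _ _ _ _ _ hβ.mul_right _ _ _ (hβ.self_eq_one a)
    (hβ.self_eq_one b) hab hba (by simp) (fun t => hβ.eq_one_or _ _)
    (fun t => hβ.eq_one_or _ _) hβ.mul_left
  have hne : (1 : ℝˣ) ≠ -1 := fun h => by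
    have := congrArg Units.val h
    norm_num at this
  have hKT : ∀ k ∈ K, k ∈ twoTorsion T := fun k hk => by
    have h : β a k = 1 := hk.1
    rw [ha] at h
    by_contra hk'
    rw [mem_twoTorsion] at hk'
    rw [if_neg hk'] at h
    exact hne h.symm
  have hfK : f ∈ K := ⟨hfr a, hfr b⟩
  let μK : K → ℤˣ := fun k => μ ⟨k, hKT k k.2⟩
  have hμK : IsQuadraticForm μK :=
    { elementary := fun t => Subtype.ext (by
        rw [pow_two]
        exact mem_twoTorsion.1 (hKT t t.2))
      map_one := hμ.map_one
      polar_mul_left := fun x y z =>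
        hμ.polar_mul_left ⟨x, hKT x x.2⟩ ⟨y, hKT y y.2⟩ ⟨z, hKT z z.2⟩
      polar_mul_right := fun x y z =>
        hμ.polar_mul_right ⟨x, hKT x x.2⟩ ⟨y, hKT y y.2⟩ ⟨z, hKT z z.2⟩ }
  have hresK : ∀ k l : K, ((β k l : ℝˣ) : ℝ) = ((polar μK k l : ℤˣ) : ℤ) := fun k l =>
    hres ⟨k, hKT k k.2⟩ ⟨l, hKT l l.2⟩
  have hresK' : ∀ k l : K, β k l = 1 ↔ polar μK k l = 1 := fun k l => by
    have h := hresK k l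
    rcases Int.units_eq_one_or (polar μK k l) with h2 | h2
    · rw [h2] at h ⊢
      simpa using h
    · rw [h2] at h ⊢
      have h3 : β k l = -1 := Units.ext (by simpa using h)
      rw [h3]
      exact ⟨fun h => absurd h.symm hne, fun h => absurd h (by decide)⟩
  have hrK : radical (polar μK) = {1, ⟨f, hfK⟩} := by
    ext k
    constructor
    · intro hk
      have : (k : T) ∈ radical β :=
        hradK k.2 fun l hl => (hresK' ⟨l, hl⟩ k).2 (hk ⟨l, hl⟩)
      rw [hr] at this
      rcases this with h | h
      · exact Or.inl (Subtype.ext h)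
      · exact Or.inr (Subtype.ext h)
    · rintro (rfl | rfl)
      · exact fun l => (hresK' l 1).1 (hβ.one_right _)
      · exact fun l => (hresK' l ⟨f, hfK⟩).1 (hfr _)
  obtain ⟨k, ψ, hψ, hψf⟩ := hμK.exists_normalForm (f := ⟨f, hfK⟩) hfμ hrK
  obtain ⟨φa, hφa⟩ := exists_zmodHom 2 a (by rw [pow_two, haa])
  obtain ⟨φb, hφb⟩ := exists_zmodHom 4 b (by
    rw [show 4 = 2 + 2 by norm_num, pow_add, pow_two, hb, hff])
  let κ : (Fin k → Z2 × Z2) →* K := ψ.toMonoidHom.comp (MonoidHom.inl _ _)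
  have hκ : ∀ x, κ x = ψ (x, 1) := fun _ => rfl
  let Φ : (Fin k → Z2 × Z2) × (Z2 × Z4) →* T := (K.subtype.comp κ).coprod (φa.coprod φb)
  have hΦ : ∀ x, Φ x = κ x.1 * (a ^ expo x.2.1 * b ^ expo x.2.2) := fun x => by
    simp [Φ, hφa, hφb]
  have hκa : ∀ x, β a (κ x) = 1 := fun x => (κ x).2.1
  have hκb : ∀ x, β b (κ x) = 1 := fun x => (κ x).2.2
  have hκa' : ∀ x, β (κ x) a = 1 := fun x => by
    have := hβ.symm a (κ x)
    rwa [hκa, one_mul] at this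
  have hκb' : ∀ x, β (κ x) b = 1 := fun x => by
    have := hβ.symm b (κ x)
    rwa [hκb, one_mul] at this
  have hexp2 : ∀ i : Z2, Even (expo i) → i = 1 := by decide
  have hexp4 : ∀ j : Z4, Even (expo j) → j = 1 ∨ j = Multiplicative.ofAdd 2 := by decide
  have heven : ∀ n : ℕ, (-1 : ℝˣ) ^ n = 1 → Even n := fun n h => by
    by_contra hn
    rw [Nat.not_even_iff_odd] at hn
    rw [hn.neg_one_pow] at h
    exact hne h.symm
  have hbij : Function.Bijective Φ := by
    constructor
    · refine (injective_iff_map_eq_one Φ).2 ?_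
      rintro ⟨x, i, j⟩ h
      rw [hΦ] at h
      have hj := congrArg (β a) h
      rw [hβ.mul_right, hβ.mul_right, hβ.pow_right, hβ.pow_right, hβ.self_eq_one, hab,
        hβ.one_right, hκa, one_pow, one_mul, one_mul] at hj
      have hi := congrArg (β b) h
      rw [hβ.mul_right, hβ.mul_right, hβ.pow_right, hβ.pow_right, hβ.self_eq_one, hba,
        hβ.one_right, hκb, one_pow, mul_one, one_mul] at hi
      obtain rfl := hexp2 i (heven _ hi)
      rcases hexp4 j (heven _ hj) with rfl | rfl
      · change (κ x : T) * (a ^ 0 * b ^ 0) = 1 at h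
        rw [pow_zero, pow_zero, mul_one, mul_one, hκ] at h
        have := ψ.map_eq_one_iff.1 (Subtype.ext h)
        rw [Prod.mk_eq_one] at this ⊢
        exact ⟨this.1, rfl⟩
      · -- the element `b² = f` does not lie in the sum of the hyperbolic planes
        change (κ x : T) * (a ^ 0 * b ^ 2) = 1 at h
        rw [pow_zero, one_mul, pow_two, hb, hκ] at h
        have h2 : ψ (x, 1) * ⟨f, hfK⟩ = 1 := Subtype.ext h
        rw [← hψf, ← map_mul, ψ.map_eq_one_iff, Prod.mk_mul_mk, Prod.mk_eq_one] at h2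
        exact absurd h2.2 (by decide)
    · rw [← MonoidHom.range_eq_top, eq_top_iff]
      intro t _
      have hκmem : ∀ l : K, (l : T) ∈ Φ.range := by
        intro l
        obtain ⟨⟨x, z⟩, rfl⟩ := ψ.surjective l
        have hz : ∀ z : Z2, z = 1 ∨ z = Multiplicative.ofAdd 1 := by decide
        rcases hz z with rfl | rfl
        · refine ⟨(x, 1), ?_⟩
          rw [hΦ]
          change (κ x : T) * (a ^ 0 * b ^ 0) = _
          rw [pow_zero, pow_zero, mul_one, mul_one, hκ]
        · refine ⟨(x, (1, Multiplicative.ofAdd 2)), ?_⟩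
          rw [hΦ]
          change (κ x : T) * (a ^ 0 * b ^ 2) = _
          rw [pow_zero, one_mul, pow_two, hb, hκ,
            show ((x, Multiplicative.ofAdd 1) : (Fin k → Z2 × Z2) × Z2)
              = (x, 1) * (1, Multiplicative.ofAdd 1) by simp, map_mul, hψf]
          rfl
      have hamem : a ∈ Φ.range := ⟨(1, (Multiplicative.ofAdd 1, 1)), by
        rw [hΦ, map_one]
        change 1 * (a ^ 1 * b ^ 0) = a
        rw [pow_zero, pow_one, mul_one, one_mul]⟩
      have hbmem : b ∈ Φ.range := ⟨(1, (1, Multiplicative.ofAdd 1)), by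
        rw [hΦ, map_one]
        change 1 * (a ^ 0 * b ^ 1) = b
        rw [pow_zero, pow_one, one_mul, one_mul]⟩
      obtain ⟨i, j, hij⟩ := hdec t
      exact (Subgroup.mul_mem_cancel_right _ (mul_mem (pow_mem hamem i) (pow_mem hbmem j))).1
        (hκmem ⟨_, hij⟩)
  have hpl : ∀ x, μK (κ x) = planesForm k x := fun x => by
    rw [hκ, hψ, formOne]
    exact mul_one _
  refine ⟨k, MulEquiv.ofBijective Φ hbij, fun x y => ?_, fun x h => ?_⟩
  · simp only [MulEquiv.ofBijective_apply, hΦ]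
    have hκκ : ((β (κ x.1) (κ y.1) : ℝˣ) : ℝ) = ((polar (planesForm k) x.1 y.1 : ℤˣ) : ℤ) := by
      rw [hresK, polar, polar, ← map_mul, hpl, hpl, hpl]
    have hc : β (a ^ expo x.2.1 * b ^ expo x.2.2) (a ^ expo y.2.1 * b ^ expo y.2.2)
        = (-1) ^ (expo x.2.1 * expo y.2.2 + expo x.2.2 * expo y.2.1) := by
      simp only [hβ.mul_left, hβ.mul_right, hβ.pow_left, hβ.pow_right, hβ.self_eq_one, hab, hba,
        one_pow, one_mul, mul_one]
      rw [← pow_mul, ← pow_mul, ← pow_add, mul_comm (expo x.2.1), mul_comm (expo x.2.2)]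
    have h1 : β (κ x.1) (a ^ expo y.2.1 * b ^ expo y.2.2) = 1 := by
      rw [hβ.mul_right, hβ.pow_right, hβ.pow_right, hκa', hκb', one_pow, one_pow, one_mul]
    have h2 : β (a ^ expo x.2.1 * b ^ expo x.2.2) (κ y.1) = 1 := by
      rw [hβ.mul_left, hβ.pow_left, hβ.pow_left, hκa, hκb, one_pow, one_pow, one_mul]
    rw [hβ.mul_left, hβ.mul_right (κ x.1) (κ y.1), hβ.mul_right _ (κ y.1 : T), h1, h2,
      mul_one, one_mul, Units.val_mul, hκκ, hc,
      bicharTwo, cyclicBichar]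
    push_cast
    rfl
  · obtain ⟨x, i, j⟩ := x
    have hxT : ((κ x : T)) ∈ twoTorsion T := hKT _ (κ x).2
    have hj : Even (expo j) := by
      apply heven
      have h3 : Φ (x, (i, j)) * Φ (x, (i, j)) = 1 := mem_twoTorsion.1 h
      have h4 := ha (Φ (x, (i, j)))
      rwa [if_pos h3, hΦ, hβ.mul_right, hβ.mul_right, hβ.pow_right, hβ.pow_right, hβ.self_eq_one,
        hab, hκa, one_pow, one_mul, one_mul] at h4
    have hprod : ∀ u v : twoTorsion T, β u v = 1 → μ (u * v) = μ u * μ v := fun u v huv => by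
      rw [map_mul_eq_polar μ]
      have h1 := hres u v
      rw [huv] at h1
      rcases Int.units_eq_one_or (polar μ u v) with h2 | h2
      · rw [h2, one_mul]
      · rw [h2] at h1
        norm_num at h1
    have hai : ∀ (i : Z2) (h : a ^ expo i ∈ twoTorsion T), μ ⟨a ^ expo i, h⟩ = 1 := by
      intro i h
      have hz : ∀ z : Z2, expo z = 0 ∨ expo z = 1 := by decide
      rcases hz i with h | h
      · simp only [h, pow_zero]
        exact hμ.map_one
      · simp only [h, pow_one]
        exact hμa
    have hbj : ∀ h : b ^ expo j ∈ twoTorsion T, μ ⟨b ^ expo j, h⟩ = (-1) ^ (expo j / 2) := by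
      intro h
      rcases hexp4 j hj with rfl | rfl
      · simp only [show b ^ expo (1 : Z4) = 1 from pow_zero b]
        exact hμ.map_one
      · simp only [show expo (Multiplicative.ofAdd (2 : ZMod 4)) = 2 from rfl, pow_two b, hb]
        exact hfμ
    have hbT : b ^ expo j ∈ twoTorsion T := by
      rcases hexp4 j hj with rfl | rfl
      · rw [show b ^ expo (1 : Z4) = 1 from pow_zero b]
        exact one_mem _
      · change b ^ 2 ∈ twoTorsion T
        rwa [pow_two, hb]
    have haT' : a ^ expo i ∈ twoTorsion T := pow_mem haT _
    have e : (⟨MulEquiv.ofBijective Φ hbij (x, (i, j)), h⟩ : twoTorsion T)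
        = ⟨κ x, hxT⟩ * (⟨a ^ expo i, haT'⟩ * ⟨b ^ expo j, hbT⟩) :=
      Subtype.ext (hΦ _)
    have hbar : β b (b ^ expo j) = 1 := by rw [hβ.pow_right, hβ.self_eq_one, one_pow]
    rw [e, hprod, hprod, hai, hbj, one_mul]
    · exact congrArg (· * _) (hpl x)
    · simp only
      rw [hβ.pow_left, hβ.pow_right, hab, hj.neg_one_pow, one_pow]
    · simp only [Subgroup.coe_mul]
      rw [hβ.mul_right, hβ.pow_right, hβ.pow_right, hκa', hκb', one_pow, one_pow, one_mul]

end NormalForm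

/-! ### Tensor products of twisted group algebras -/

section Tensor

variable {G H A B : Type*} [Ring A] [Algebra ℝ A] [Ring B]
  [Algebra ℝ B] {b : Basis G ℝ A} {c : Basis H ℝ B}

lemma tensorGrading_eq_span {Γ : Family G A} {Γ' : Family H B}
    (h : ∀ g, Γ g = Submodule.span ℝ {b g}) (h' : ∀ g, Γ' g = Submodule.span ℝ {c g})
    (p : G × H) : tensorGrading Γ Γ' p = Submodule.span ℝ {b.tensorProduct c p} := by
  rw [tensorGrading, h, h', Submodule.map₂_span_span, Set.image2_singleton,
    Basis.tensorProduct_apply']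
  rfl

lemma tensor_mul_self {g : G} {h : H} {μ ν : ℤˣ}
    (hg : b g * b g = (((μ : ℤˣ) : ℤ) : ℝ) • (1 : A))
    (hh : c h * c h = (((ν : ℤˣ) : ℤ) : ℝ) • (1 : B)) :
    b.tensorProduct c (g, h) * b.tensorProduct c (g, h)
      = (((μ * ν : ℤˣ) : ℤ) : ℝ) • (1 : A ⊗[ℝ] B) := by
  rw [Basis.tensorProduct_apply, Algebra.TensorProduct.tmul_mul_tmul, hg, hh,
    TensorProduct.smul_tmul_smul, Algebra.TensorProduct.one_def]
  push_cast
  rfl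

/-- The basis of pure tensors of basis elements. -/
def powBasis (b : Basis G ℝ A) (k : ℕ) : Basis (Fin k → G) ℝ (TensorPow A k) :=
  Basis.piTensorProduct (fun _ : Fin k => b)

lemma powBasis_apply (b : Basis G ℝ A) (k : ℕ) (x : Fin k → G) :
    powBasis b k x = TensorPow.pure fun i => b (x i) :=
  Basis.piTensorProduct_apply _ _

lemma TensorPow.pure_mul {k : ℕ} (x y : Fin k → A) :
    TensorPow.pure x * TensorPow.pure y = TensorPow.pure fun i => x i * y i :=
  PiTensorProduct.tprod_mul_tprod x y

lemma TensorPow.pure_one (k : ℕ) : TensorPow.pure (fun _ : Fin k => (1 : A)) = 1 := rfl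

lemma TensorPow.pure_smul {k : ℕ} (r : Fin k → ℝ) (x : Fin k → A) :
    TensorPow.pure (fun i => r i • x i) = (∏ i, r i) • TensorPow.pure x :=
  (PiTensorProduct.tprod ℝ).map_smul_univ r x

lemma tensorPowerGrading_eq_span {Γ : Family G A} (h : ∀ g, Γ g = Submodule.span ℝ {b g}) (k : ℕ)
    (x : Fin k → G) : tensorPowerGrading Γ k x = Submodule.span ℝ {powBasis b k x} := by
  rw [powBasis_apply]
  refine le_antisymm (Submodule.span_le.2 ?_) (Submodule.span_mono ?_)
  · rintro _ ⟨y, hy, rfl⟩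
    have : ∀ i, ∃ r : ℝ, r • b (x i) = y i := fun i => by
      have := hy i
      rwa [h, Submodule.mem_span_singleton] at this
    choose r hr using this
    rw [← funext hr, TensorPow.pure_smul]
    exact Submodule.smul_mem _ _ (Submodule.mem_span_singleton_self _)
  · rintro _ rfl
    exact ⟨_, fun i => by rw [h]; exact Submodule.mem_span_singleton_self _, rfl⟩

lemma powBasis_mul_self {μ : G → ℤˣ}
    (h : ∀ g, b g * b g = (((μ g : ℤˣ) : ℤ) : ℝ) • (1 : A)) (k : ℕ) (x : Fin k → G) :
    powBasis b k x * powBasis b k x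
      = (((∏ i, μ (x i) : ℤˣ) : ℤ) : ℝ) • (1 : TensorPow A k) := by
  simp only [powBasis_apply, TensorPow.pure_mul, h, TensorPow.pure_smul, TensorPow.pure_one]
  push_cast
  rfl

variable [CommGroup G] [CommGroup H]

lemma IsTwisted.tensor (hb : IsTwisted b) (hc : IsTwisted c) :
    IsTwisted (b.tensorProduct c) where
  one := by
    rw [Prod.one_eq_mk, Basis.tensorProduct_apply, hb.one, hc.one]
    rfl
  exists_mul u v := by
    refine ⟨hb.cocycle u.1 v.1 * hc.cocycle u.2 v.2, ?_⟩
    rw [Basis.tensorProduct_apply', Basis.tensorProduct_apply', Basis.tensorProduct_apply',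
      Algebra.TensorProduct.tmul_mul_tmul, hb.mul, hc.mul, TensorProduct.smul_tmul_smul,
      Units.val_mul]
    rfl

lemma IsTwisted.comm_tensor (hb : IsTwisted b) (hc : IsTwisted c) (u v : G × H) :
    (hb.tensor hc).comm u v = hb.comm u.1 v.1 * hc.comm u.2 v.2 := by
  refine (Units.ext ((hb.tensor hc).comm_unique ?_)).symm
  rw [Basis.tensorProduct_apply', Basis.tensorProduct_apply',
    Algebra.TensorProduct.tmul_mul_tmul, Algebra.TensorProduct.tmul_mul_tmul,
    hb.mul_comm_eq, hc.mul_comm_eq, TensorProduct.smul_tmul_smul, Units.val_mul]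

lemma IsTwisted.pow (hb : IsTwisted b) (k : ℕ) : IsTwisted (powBasis b k) where
  one := by
    simp only [powBasis_apply, Pi.one_apply, hb.one, TensorPow.pure_one]
  exists_mul u v := by
    refine ⟨∏ i, hb.cocycle (u i) (v i), ?_⟩
    simp only [powBasis_apply, TensorPow.pure_mul, hb.mul, TensorPow.pure_smul, Units.coe_prod]
    rfl

end Tensor

/-! ### The algebras generated by two anticommuting elements -/

section Pair

/-- The monomials `A^i B^j`, indexed by `Z_2 × Z_n`. -/
def monomial {D : Type*} [Ring D] {n : ℕ} (A B : D)
    (x : Z2 × Multiplicative (ZMod n)) : D :=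
  A ^ expo x.1 * B ^ expo x.2

lemma monomial_one {D : Type*} [Ring D] {n : ℕ} [NeZero n] (A B : D) :
    monomial A B (1 : Z2 × Multiplicative (ZMod n)) = 1 := by
  have h : ∀ m [NeZero m], expo (1 : Multiplicative (ZMod m)) = 0 := fun m _ => ZMod.val_zero
  simp only [monomial, Prod.fst_one, Prod.snd_one, h, pow_zero, one_mul]

variable {D : Type*} [Ring D] [Algebra ℝ D] {n : ℕ} {A B : D}
  (hA : A * A = 1) (hBA : B * A = -(A * B))

include hBA in
lemma pow_mul_pow_of_anticomm (i j : ℕ) : B ^ j * A ^ i = (-1 : ℝ) ^ (j * i) • (A ^ i * B ^ j) := by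
  have h1 : ∀ j, B ^ j * A = (-1 : ℝ) ^ j • (A * B ^ j) := by
    intro j
    induction j with
    | zero => simp
    | succ j ih =>
      rw [pow_succ' B, mul_assoc, ih, mul_smul_comm, ← mul_assoc, hBA, pow_succ', mul_smul,
        neg_one_smul, neg_mul, smul_neg, mul_assoc]
  induction i with
  | zero => simp
  | succ i ih =>
    rw [pow_succ, ← mul_assoc, ih, smul_mul_assoc, mul_assoc, h1, mul_smul_comm, smul_smul,
      ← pow_add, ← mul_assoc, Nat.mul_succ]

include hBA in
lemma pow_mul_pow_mul_of_anticomm (i j k l : ℕ) :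
    (A ^ i * B ^ j) * (A ^ k * B ^ l) = (-1 : ℝ) ^ (j * k) • (A ^ (i + k) * B ^ (j + l)) := by
  rw [mul_assoc, ← mul_assoc (B ^ j), pow_mul_pow_of_anticomm hBA, smul_mul_assoc, mul_smul_comm,
    pow_add, pow_add]
  simp only [mul_assoc]

include hBA in
lemma monomial_mul_comm (x y : Z2 × Multiplicative (ZMod n)) :
    monomial A B x * monomial A B y = (-1 : ℝ) ^ (expo x.1 * expo y.2 + expo x.2 * expo y.1) •
      (monomial A B y * monomial A B x) := by
  simp only [monomial]
  rw [pow_mul_pow_mul_of_anticomm hBA, pow_mul_pow_mul_of_anticomm hBA, smul_smul, ← pow_add, add_comm (expo y.1),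
    add_comm (expo y.2), show expo x.1 * expo y.2 + expo x.2 * expo y.1 + expo y.2 * expo x.1
      = expo x.2 * expo y.1 + 2 * (expo x.1 * expo y.2) by ring, pow_add _ _ (2 * _), pow_mul]
  simp

include hA hBA in
lemma exists_monomial_mul [NeZero n] {s : ℝˣ} (hB : B ^ n = (s : ℝ) • (1 : D))
    (x y : Z2 × Multiplicative (ZMod n)) :
    ∃ c : ℝˣ, monomial A B x * monomial A B y = (c : ℝ) • monomial A B (x * y) := by
  have hred : ∀ m : ℕ, B ^ m = ((s ^ (m / n) : ℝˣ) : ℝ) • B ^ (m % n) := fun m => by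
    conv_lhs => rw [← Nat.div_add_mod m n, pow_add, pow_mul, hB, smul_pow, one_pow, smul_mul_assoc,
      one_mul]
    rw [Units.val_pow_eq_pow_val]
  have hredA : ∀ m : ℕ, A ^ m = A ^ (m % 2) := fun m => by
    conv_lhs => rw [← Nat.div_add_mod m 2, pow_add, pow_mul, pow_two, hA, one_pow, one_mul]
  refine ⟨(-1) ^ (expo x.2 * expo y.1) * s ^ ((expo x.2 + expo y.2) / n), ?_⟩
  simp only [monomial]
  rw [pow_mul_pow_mul_of_anticomm hBA, hred, hredA, mul_smul_comm, smul_smul]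
  simp only [expo, Prod.fst_mul, Prod.snd_mul, toAdd_mul, ZMod.val_add]
  push_cast
  rfl

end Pair

lemma sum_Z2 {M : Type*} [AddCommMonoid M] (f : Z2 → M) :
    ∑ x, f x = f (Multiplicative.ofAdd 0) + f (Multiplicative.ofAdd 1) := by
  rw [← Equiv.sum_comp (Multiplicative.ofAdd : ZMod 2 ≃ Z2) f]
  exact Fin.sum_univ_two (fun i : Fin 2 => f (Multiplicative.ofAdd (i : ZMod 2)))

lemma sum_Z4 {M : Type*} [AddCommMonoid M] (f : Z4 → M) :
    ∑ x, f x = f (Multiplicative.ofAdd 0) + f (Multiplicative.ofAdd 1)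
      + f (Multiplicative.ofAdd 2) + f (Multiplicative.ofAdd 3) := by
  rw [← Equiv.sum_comp (Multiplicative.ofAdd : ZMod 4 ≃ Z4) f]
  exact Fin.sum_univ_four (fun i : Fin 4 => f (Multiplicative.ofAdd (i : ZMod 4)))

lemma forall_Z2 {p : Z2 → Prop} :
    (∀ x, p x) ↔ p (Multiplicative.ofAdd 0) ∧ p (Multiplicative.ofAdd 1) := by
  refine ⟨fun h => ⟨h _, h _⟩, fun h x => ?_⟩
  have : ∀ x : Z2, x = Multiplicative.ofAdd 0 ∨ x = Multiplicative.ofAdd 1 := by decide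
  rcases this x with rfl | rfl
  exacts [h.1, h.2]

lemma forall_Z4 {p : Z4 → Prop} :
    (∀ x, p x) ↔ p (Multiplicative.ofAdd 0) ∧ p (Multiplicative.ofAdd 1)
      ∧ p (Multiplicative.ofAdd 2) ∧ p (Multiplicative.ofAdd 3) := by
  refine ⟨fun h => ⟨h _, h _, h _, h _⟩, fun h x => ?_⟩
  have : ∀ x : Z4, x = Multiplicative.ofAdd 0 ∨ x = Multiplicative.ofAdd 1 ∨
    x = Multiplicative.ofAdd 2 ∨ x = Multiplicative.ofAdd 3 := by decide
  rcases this x with rfl | rfl | rfl | rfl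
  exacts [h.1, h.2.1, h.2.2.1, h.2.2.2]

/-! ### The building blocks -/

section Blocks

open Matrix

/-- The generator of degree `a` in `M_2(ℝ)` and in `M_2(ℂ)`. -/
def swapMatrix (R : Type*) [Ring R] : Matrix (Fin 2) (Fin 2) R := !![0, 1; 1, 0]

/-- The generator of degree `b` in `M_2(ℝ)`. -/
def signMatrix : Matrix (Fin 2) (Fin 2) ℝ := !![-1, 0; 0, 1]

/-- The generator of degree `b` in `M_2(ℂ)`. -/
def omegaMatrix : Matrix (Fin 2) (Fin 2) ℂ := !![omega, 0; 0, -omega]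

lemma swapMatrix_mul_self (R : Type*) [Ring R] : swapMatrix R * swapMatrix R = 1 := by
  ext i j
  fin_cases i <;> fin_cases j <;> simp [swapMatrix]

lemma signMatrix_mul_self : signMatrix * signMatrix = 1 := by
  ext i j
  fin_cases i <;> fin_cases j <;> simp [signMatrix]

lemma signMatrix_swapMatrix : signMatrix * swapMatrix ℝ = -(swapMatrix ℝ * signMatrix) := by
  ext i j
  fin_cases i <;> fin_cases j <;> simp [signMatrix, swapMatrix]

lemma omegaMatrix_swapMatrix : omegaMatrix * swapMatrix ℂ = -(swapMatrix ℂ * omegaMatrix) := by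
  ext i j
  fin_cases i <;> fin_cases j <;> simp [omegaMatrix, swapMatrix]

lemma omega_sq : omega ^ 2 = Complex.I := by
  rw [omega, ← Complex.exp_nat_mul,
    show ((2 : ℕ) : ℂ) * (Complex.I * Real.pi / 4) = Real.pi / 2 * Complex.I by push_cast; ring]
  exact Complex.exp_pi_div_two_mul_I

lemma omega_ne_zero : omega ≠ 0 := Complex.exp_ne_zero _

lemma omegaMatrix_sq : omegaMatrix ^ 2 = !![Complex.I, 0; 0, Complex.I] := by
  rw [pow_two, ← omega_sq]
  ext i j
  fin_cases i <;> fin_cases j <;> simp [omegaMatrix, pow_two]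

lemma omegaMatrix_cube : omegaMatrix ^ 3 = !![omega ^ 3, 0; 0, -omega ^ 3] := by
  rw [pow_succ, omegaMatrix_sq, ← omega_sq]
  ext i j
  fin_cases i <;> fin_cases j <;> simp [omegaMatrix] <;> ring

lemma omegaMatrix_pow_four : omegaMatrix ^ 4 = (-1 : ℝ) • 1 := by
  rw [show 4 = 2 * 2 by norm_num, pow_mul, omegaMatrix_sq, pow_two]
  ext i j
  fin_cases i <;> fin_cases j <;> simp

lemma linearIndependent_monomial_real :
    LinearIndependent ℝ (monomial (n := 2) (swapMatrix ℝ) signMatrix) := by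
  rw [Fintype.linearIndependent_iff]
  intro c hc
  rw [Fintype.sum_prod_type, sum_Z2, sum_Z2, sum_Z2] at hc
  have e0 : ∀ i j, monomial (n := 2) (swapMatrix ℝ) signMatrix
      (Multiplicative.ofAdd i, Multiplicative.ofAdd j)
        = swapMatrix ℝ ^ i.val * signMatrix ^ j.val := fun _ _ => rfl
  simp only [e0, ZMod.val_zero, ZMod.val_one, pow_zero, pow_one, one_mul, mul_one] at hc
  have h00 := congrFun (congrFun hc 0) 0
  have h01 := congrFun (congrFun hc 0) 1
  have h10 := congrFun (congrFun hc 1) 0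
  have h11 := congrFun (congrFun hc 1) 1
  simp [swapMatrix, signMatrix, -ofAdd_zero] at h00 h01 h10 h11
  rw [Prod.forall, forall_Z2, forall_Z2, forall_Z2]
  refine ⟨⟨?_, ?_⟩, ?_, ?_⟩ <;> linarith

lemma linearIndependent_monomial_complex :
    LinearIndependent ℝ (monomial (n := 4) (swapMatrix ℂ) omegaMatrix) := by
  rw [Fintype.linearIndependent_iff]
  intro c hc
  rw [Fintype.sum_prod_type, sum_Z2, sum_Z4, sum_Z4] at hc
  have e0 : ∀ i j, monomial (n := 4) (swapMatrix ℂ) omegaMatrix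
      (Multiplicative.ofAdd i, Multiplicative.ofAdd j)
        = swapMatrix ℂ ^ i.val * omegaMatrix ^ j.val := fun _ _ => rfl
  simp only [e0, ZMod.val_zero, ZMod.val_one, show (1 : ZMod 4).val = 1 from rfl,
    show (2 : ZMod 4).val = 2 from rfl, show (3 : ZMod 4).val = 3 from rfl,
    pow_zero, pow_one, one_mul, mul_one, omegaMatrix_sq, omegaMatrix_cube] at hc
  have h00 := congrFun (congrFun hc 0) 0
  have h01 := congrFun (congrFun hc 0) 1
  have h10 := congrFun (congrFun hc 1) 0
  have h11 := congrFun (congrFun hc 1) 1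
  have hω : omega ^ 3 = omega * Complex.I := by rw [pow_succ, omega_sq, mul_comm]
  simp [swapMatrix, omegaMatrix, hω, -ofAdd_zero] at h00 h01 h10 h11
  have key : ∀ p q r s : ℝ, (p : ℂ) + q * omega + r * Complex.I + s * (omega * Complex.I) = 0 →
      (p : ℂ) - q * omega + r * Complex.I - s * (omega * Complex.I) = 0 →
      (p = 0 ∧ q = 0 ∧ r = 0 ∧ s = 0) := by
    intro p q r s h h'
    -- the sum and the difference of the two equations separate the even and odd powers of `ω`
    have h1 : (p : ℂ) + r * Complex.I = 0 := by linear_combination (h + h') / 2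
    have h2 : omega * ((q : ℂ) + s * Complex.I) = 0 := by linear_combination (h - h') / 2
    have h2 := (mul_eq_zero.1 h2).resolve_left omega_ne_zero
    have a1 := congrArg Complex.re h1
    have a2 := congrArg Complex.im h1
    have a3 := congrArg Complex.re h2
    have a4 := congrArg Complex.im h2
    simp at a1 a2 a3 a4
    exact ⟨a1, a3, a2, a4⟩
  obtain ⟨a1, a2, a3, a4⟩ := key _ _ _ _ h00 (by linear_combination h11)
  obtain ⟨b1, b2, b3, b4⟩ := key _ _ _ _ h10 (by linear_combination h01)
  rw [Prod.forall, forall_Z2, forall_Z4, forall_Z4]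
  exact ⟨⟨a1, a2, a3, a4⟩, b1, b2, b3, b4⟩

/-- The homogeneous basis of `M_2(ℝ)`. -/
def basisM2R : Basis (Z2 × Z2) ℝ (Matrix (Fin 2) (Fin 2) ℝ) :=
  basisOfLinearIndependentOfCardEqFinrank linearIndependent_monomial_real
    (by simp [Module.finrank_matrix])

/-- The homogeneous basis of `M_2(ℂ)`. -/
def basisM2C : Basis (Z2 × Z4) ℝ (Matrix (Fin 2) (Fin 2) ℂ) :=
  basisOfLinearIndependentOfCardEqFinrank linearIndependent_monomial_complex
    (by simp [Module.finrank_matrix])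

lemma basisM2R_apply (x : Z2 × Z2) : basisM2R x = monomial (swapMatrix ℝ) signMatrix x := by
  simp [basisM2R]

lemma basisM2C_apply (x : Z2 × Z4) : basisM2C x = monomial (swapMatrix ℂ) omegaMatrix x := by
  simp [basisM2C]

lemma isTwisted_basisM2R : IsTwisted basisM2R where
  one := by rw [basisM2R_apply, monomial_one]
  exists_mul u v := by
    simp only [basisM2R_apply]
    refine exists_monomial_mul (swapMatrix_mul_self ℝ) signMatrix_swapMatrix (s := 1) ?_ u v
    rw [pow_two, signMatrix_mul_self, Units.val_one, one_smul]

lemma isTwisted_basisM2C : IsTwisted basisM2C where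
  one := by rw [basisM2C_apply, monomial_one]
  exists_mul u v := by
    simp only [basisM2C_apply]
    refine exists_monomial_mul (swapMatrix_mul_self ℂ) omegaMatrix_swapMatrix (s := -1) ?_ u v
    rw [omegaMatrix_pow_four]
    simp

lemma basisM2R_mul_self (x : Z2 × Z2) :
    basisM2R x * basisM2R x = (((planeForm x : ℤˣ) : ℤ) : ℝ) • 1 := by
  rw [basisM2R_apply, monomial, pow_mul_pow_mul_of_anticomm signMatrix_swapMatrix, ← two_mul, ← two_mul,
    pow_mul (swapMatrix ℝ) 2, pow_mul signMatrix 2, pow_two, pow_two, swapMatrix_mul_self,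
    signMatrix_mul_self, one_pow, one_pow,
    one_mul, planeForm, mul_comm (expo x.2)]
  push_cast
  rfl

lemma basisM2C_mul_self {x : Z2 × Z4} (hx : x * x = 1) :
    basisM2C x * basisM2C x = (((cyclicForm x : ℤˣ) : ℤ) : ℝ) • 1 := by
  obtain ⟨d, hd⟩ : Even (expo x.2) := by
    have h : x.2 * x.2 = 1 := congrArg Prod.snd hx
    have : ∀ j : Z4, j * j = 1 → Even (expo j) := by decide
    exact this _ h
  have h2 : (2 * expo x.2) = 4 * d := by omega
  have h3 : expo x.2 / 2 = d := by omega
  rw [basisM2C_apply, monomial, pow_mul_pow_mul_of_anticomm omegaMatrix_swapMatrix, ← two_mul, ← two_mul, h2,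
    pow_mul _ 2, pow_mul _ 4, pow_two, swapMatrix_mul_self, omegaMatrix_pow_four, one_pow, one_mul,
    cyclicForm, h3, smul_pow, one_pow, Even.neg_one_pow (Even.mul_right ⟨d, hd⟩ _), one_smul]
  push_cast
  rfl

lemma comm_basisM2C (x y : Z2 × Z4) :
    ((isTwisted_basisM2C.comm x y : ℝˣ) : ℝ) = ((cyclicBichar x y : ℤˣ) : ℤ) := by
  refine (isTwisted_basisM2C.comm_unique ?_).symm
  rw [basisM2C_apply, basisM2C_apply, monomial_mul_comm omegaMatrix_swapMatrix, cyclicBichar]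
  push_cast
  rfl

lemma gradingM2R_eq_span : ∀ x, gradingM2R x = Submodule.span ℝ {basisM2R x} := by
  simp only [basisM2R_apply]
  have e0 : ∀ i j, monomial (n := 2) (swapMatrix ℝ) signMatrix
      (Multiplicative.ofAdd i, Multiplicative.ofAdd j)
        = swapMatrix ℝ ^ i.val * signMatrix ^ j.val := fun _ _ => rfl
  rw [Prod.forall, forall_Z2, forall_Z2, forall_Z2]
  simp only [e0, ZMod.val_zero, ZMod.val_one, pow_zero, pow_one, one_mul, mul_one]
  refine ⟨⟨?_, ?_⟩, ?_, ?_⟩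
  · change Submodule.span ℝ {!![1, 0; 0, 1]} = _
    rw [Matrix.one_fin_two]
  · rfl
  · rfl
  · -- the entry `ab` of the table is the negative of the product of the entries `a` and `b`
    change Submodule.span ℝ {!![0, -1; 1, 0]} = _
    rw [← Submodule.span_singleton_smul_eq (isUnit_one.neg : IsUnit (-1 : ℝ))]
    congr 2
    ext i j
    fin_cases i <;> fin_cases j <;> simp [swapMatrix, signMatrix]

lemma gradingM2C_eq_span : ∀ x, gradingM2C x = Submodule.span ℝ {basisM2C x} := by
  simp only [basisM2C_apply]
  have e0 : ∀ i j, monomial (n := 4) (swapMatrix ℂ) omegaMatrix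
      (Multiplicative.ofAdd i, Multiplicative.ofAdd j)
        = swapMatrix ℂ ^ i.val * omegaMatrix ^ j.val := fun _ _ => rfl
  rw [Prod.forall, forall_Z2, forall_Z4, forall_Z4]
  simp only [e0, ZMod.val_zero, ZMod.val_one, show (1 : ZMod 4).val = 1 from rfl,
    show (2 : ZMod 4).val = 2 from rfl, show (3 : ZMod 4).val = 3 from rfl,
    pow_zero, pow_one, one_mul, mul_one, omegaMatrix_sq, omegaMatrix_cube]
  refine ⟨⟨?_, rfl, rfl, rfl⟩, rfl, ?_, ?_, ?_⟩
  · change Submodule.span ℝ {!![1, 0; 0, 1]} = _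
    rw [Matrix.one_fin_two]
  · change Submodule.span ℝ {!![0, -omega; omega, 0]} = _
    congr 2
    ext i j
    fin_cases i <;> fin_cases j <;> simp [swapMatrix, omegaMatrix]
  · change Submodule.span ℝ {!![0, Complex.I; Complex.I, 0]} = _
    congr 2
    ext i j
    fin_cases i <;> fin_cases j <;> simp [swapMatrix]
  · change Submodule.span ℝ {!![0, -omega ^ 3; omega ^ 3, 0]} = _
    congr 2
    ext i j
    fin_cases i <;> fin_cases j <;> simp [swapMatrix]

/-- The homogeneous basis `1, i` of `ℂ`. -/
def basisC : Basis Z2 ℝ ℂ := Complex.basisOneI.reindex (Multiplicative.ofAdd : ZMod 2 ≃ Z2)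

lemma basisC_apply : ∀ z : Z2, basisC z = Complex.I ^ expo z := by
  rw [forall_Z2]
  constructor
  · change Complex.basisOneI 0 = Complex.I ^ 0
    simp
  · change Complex.basisOneI 1 = Complex.I ^ 1
    simp

lemma basisC_mul_self (z : Z2) :
    basisC z * basisC z = ((((-1) ^ expo z : ℤˣ) : ℤ) : ℝ) • (1 : ℂ) := by
  rw [basisC_apply, ← mul_pow, Complex.I_mul_I]
  push_cast
  rw [Algebra.smul_def, mul_one, map_pow, map_neg, map_one]

lemma isTwisted_basisC : IsTwisted basisC where
  one := (basisC_apply 1).trans (pow_zero _)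
  exists_mul u v := by
    refine ⟨(-1) ^ ((expo u + expo v) / 2), ?_⟩
    simp only [basisC_apply, expo, toAdd_mul, ZMod.val_add]
    rw [← pow_add]
    conv_lhs => rw [← Nat.div_add_mod ((Multiplicative.toAdd u).val + (Multiplicative.toAdd v).val)
      2, pow_add, pow_mul, Complex.I_sq]
    simp [Algebra.smul_def]

lemma gradingC_eq_span : ∀ z, gradingC z = Submodule.span ℝ {basisC z} := by
  simp only [basisC_apply]
  rw [forall_Z2]
  constructor
  · change Submodule.span ℝ {1} = Submodule.span ℝ {Complex.I ^ 0}
    rw [pow_zero]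
  · change Submodule.span ℝ {Complex.I} = Submodule.span ℝ {Complex.I ^ 1}
    rw [pow_one]

end Blocks

/-! ### The two product gradings -/

/-- The map `A₁ ⊗ ⋯ ⊗ A_k ↦ (∏ᵢ Aᵢ (xᵢ, yᵢ))_{x, y}`, the iterated Kronecker product. -/
def kroneckerPow (k : ℕ) :
    TensorPow (Matrix (Fin 2) (Fin 2) ℝ) k →ₐ[ℝ] Matrix (Fin k → Fin 2) (Fin k → Fin 2) ℝ :=
  PiTensorProduct.liftAlgHom
    ((Matrix.ofLinearEquiv ℝ).toLinearMap.compMultilinearMap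
      (MultilinearMap.pi fun x => MultilinearMap.pi fun y =>
        (MultilinearMap.mkPiAlgebra ℝ (Fin k) ℝ).compLinearMap
          fun i => Matrix.entryLinearMap ℝ ℝ (x i) (y i)))
    (by
      ext x y
      simp only [LinearMap.compMultilinearMap_apply, LinearEquiv.coe_coe,
        Matrix.coe_ofLinearEquiv, Matrix.of_apply, MultilinearMap.pi_apply,
        MultilinearMap.compLinearMap_apply, MultilinearMap.mkPiAlgebra_apply,
        Matrix.entryLinearMap_apply, Pi.one_apply, Matrix.one_apply, Finset.prod_ite_zero]
      simp [funext_iff])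
    (by
      intro A B
      ext x y
      simp only [LinearMap.compMultilinearMap_apply, LinearEquiv.coe_coe,
        Matrix.coe_ofLinearEquiv, Matrix.of_apply, MultilinearMap.pi_apply,
        MultilinearMap.compLinearMap_apply, MultilinearMap.mkPiAlgebra_apply,
        Matrix.entryLinearMap_apply, Pi.mul_apply, Matrix.mul_apply, Finset.prod_univ_sum,
        Fintype.piFinset_univ, Finset.prod_mul_distrib])

lemma kroneckerPow_pure (k : ℕ) (A : Fin k → Matrix (Fin 2) (Fin 2) ℝ) (x y : Fin k → Fin 2) :
    kroneckerPow k (TensorPow.pure A) x y = ∏ i, A i (x i) (y i) := by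
  have h : kroneckerPow k (TensorPow.pure A) = _ := PiTensorProduct.lift.tprod A
  rw [h]
  simp

lemma kroneckerPow_bijective (k : ℕ) : Function.Bijective (kroneckerPow k) := by
  have hsurj : Function.Surjective (kroneckerPow k) := by
    intro M
    rw [← AlgHom.mem_range, Matrix.matrix_eq_sum_single M]
    refine sum_mem fun x _ => sum_mem fun y _ => ?_
    rw [show Matrix.single x y (M x y) = M x y • Matrix.single x y (1 : ℝ) by simp]
    refine Subalgebra.smul_mem _ ((AlgHom.mem_range _).2
      ⟨TensorPow.pure fun i => Matrix.single (x i) (y i) 1, ?_⟩) _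
    ext x' y'
    rw [kroneckerPow_pure]
    simp only [Matrix.single_apply, Finset.prod_ite_zero, Finset.prod_const_one]
    simp [funext_iff, forall_and]
  refine ⟨?_, hsurj⟩
  have : FiniteDimensional ℝ (TensorPow (Matrix (Fin 2) (Fin 2) ℝ) k) :=
    Module.Finite.of_basis (powBasis basisM2R k)
  refine (LinearMap.injective_iff_surjective_of_finrank_eq_finrank
    (f := (kroneckerPow k).toLinearMap) ?_).2 hsurj
  rw [finrank_eq_card_basis (powBasis basisM2R k), Module.finrank_matrix]
  simp [← mul_pow]

/-- Tensoring with `M_2(ℝ) ⊗ ⋯ ⊗ M_2(ℝ)` amounts to passing to matrices. -/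
def tensorPowEquiv (k : ℕ) (A : Type*) [Ring A] [Algebra ℝ A] :
    TensorPow (Matrix (Fin 2) (Fin 2) ℝ) k ⊗[ℝ] A ≃ₐ[ℝ]
      Matrix (Fin k → Fin 2) (Fin k → Fin 2) A :=
  (Algebra.TensorProduct.congr (AlgEquiv.ofBijective _ (kroneckerPow_bijective k))
    AlgEquiv.refl).trans
    ((Algebra.TensorProduct.comm ℝ _ _).trans (matrixEquivTensor _ ℝ A).symm)

lemma nonempty_algebraOne_equiv {m n : ℕ} (hn : n = 2 ^ m) :
    Nonempty (AlgebraOne m ≃ₐ[ℝ] Matrix (Fin n) (Fin n) ℂ) :=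
  ⟨(tensorPowEquiv m ℂ).trans (Matrix.reindexAlgEquiv ℝ ℂ
    (Fintype.equivOfCardEq (by simp [hn])))⟩

lemma nonempty_algebraTwo_equiv {m n : ℕ} (hm : 1 ≤ m) (hn : n = 2 ^ m) :
    Nonempty (AlgebraTwo m ≃ₐ[ℝ] Matrix (Fin n) (Fin n) ℂ) := by
  obtain ⟨k, rfl⟩ : ∃ k, m = k + 1 := ⟨m - 1, by omega⟩
  exact ⟨(tensorPowEquiv _ _).trans ((Matrix.compAlgEquiv _ _ ℂ ℝ).trans
    (Matrix.reindexAlgEquiv ℝ ℂ (Fintype.equivOfCardEq (by simp [hn, pow_succ]))))⟩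

section Top

variable {G D : Type*} [CommGroup G] [Ring D] [Algebra ℝ D]

/-- A homogeneous basis indexed by the whole group. -/
lemma IsTwisted.isHomogeneousBasis_top {b : Basis G ℝ D} (hb : IsTwisted b) {Γ : Family G D}
    (h : ∀ g, Γ g = Submodule.span ℝ {b g}) :
    IsHomogeneousBasis Γ ⊤ (b.reindex (Subgroup.topEquiv (G := G)).symm.toEquiv) where
  toIsTwisted := hb.reindex _
  eq_span t := by
    rw [h, Basis.reindex_apply]
    rfl
  eq_bot g hg := absurd (Subgroup.mem_top g) hg

end Top

/-- The homogeneous basis of `M_2(ℝ) ⊗ ⋯ ⊗ M_2(ℝ) ⊗ ℂ`. -/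
def basisOne (m : ℕ) : Basis ((Fin m → Z2 × Z2) × Z2) ℝ (AlgebraOne m) :=
  (powBasis basisM2R m).tensorProduct basisC

/-- The homogeneous basis of `M_2(ℝ) ⊗ ⋯ ⊗ M_2(ℝ) ⊗ M_2(ℂ)`. -/
def basisTwo (m : ℕ) : Basis ((Fin (m - 1) → Z2 × Z2) × (Z2 × Z4)) ℝ (AlgebraTwo m) :=
  (powBasis basisM2R (m - 1)).tensorProduct basisM2C

lemma isTwisted_basisOne (m : ℕ) : IsTwisted (basisOne m) :=
  (isTwisted_basisM2R.pow m).tensor isTwisted_basisC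

lemma isTwisted_basisTwo (m : ℕ) : IsTwisted (basisTwo m) :=
  (isTwisted_basisM2R.pow (m - 1)).tensor isTwisted_basisM2C

lemma modelOne_eq_span (m : ℕ) (x) : modelOne m x = Submodule.span ℝ {basisOne m x} :=
  tensorGrading_eq_span (tensorPowerGrading_eq_span gradingM2R_eq_span m) gradingC_eq_span x

lemma modelTwo_eq_span (m : ℕ) (x) : modelTwo m x = Submodule.span ℝ {basisTwo m x} :=
  tensorGrading_eq_span (tensorPowerGrading_eq_span gradingM2R_eq_span (m - 1))
    gradingM2C_eq_span x

lemma basisOne_mul_self (m : ℕ) (x) :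
    basisOne m x * basisOne m x = (((formOne m x : ℤˣ) : ℤ) : ℝ) • (1 : AlgebraOne m) :=
  tensor_mul_self (powBasis_mul_self basisM2R_mul_self m x.1) (basisC_mul_self x.2)

lemma basisTwo_mul_self (m : ℕ) {x} (hx : x * x = 1) :
    basisTwo m x * basisTwo m x = (((formTwo (m - 1) x : ℤˣ) : ℤ) : ℝ) • (1 : AlgebraTwo m) :=
  tensor_mul_self (powBasis_mul_self basisM2R_mul_self (m - 1) x.1)
    (basisM2C_mul_self (congrArg Prod.snd hx))

lemma comm_basisTwo (m : ℕ) (x y) :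
    (((isTwisted_basisTwo m).comm x y : ℝˣ) : ℝ) = ((bicharTwo (m - 1) x y : ℤˣ) : ℤ) := by
  have hb := isTwisted_basisM2R.pow (m - 1)
  have h : (((hb.comm x.1 y.1 : ℝˣ) : ℝ)) = ((polar (planesForm (m - 1)) x.1 y.1 : ℤˣ) : ℤ) := by
    refine hb.comm_eq_polar (funext fun i => ?_) (powBasis_mul_self basisM2R_mul_self _ _)
      (powBasis_mul_self basisM2R_mul_self _ _) (powBasis_mul_self basisM2R_mul_self _ _)
    have : ∀ z : Z2 × Z2, z * z = 1 := by decide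
    exact this (y.1 i)
  have h2 : (isTwisted_basisTwo m).comm x y = _ := hb.comm_tensor isTwisted_basisM2C x y
  rw [h2, Units.val_mul, h, comm_basisM2C, bicharTwo]
  push_cast
  rfl

lemma isHomogeneousBasis_modelOne (m : ℕ) : IsHomogeneousBasis (modelOne m) ⊤
    ((basisOne m).reindex Subgroup.topEquiv.symm.toEquiv) :=
  (isTwisted_basisOne m).isHomogeneousBasis_top (modelOne_eq_span m)

lemma isHomogeneousBasis_modelTwo (m : ℕ) : IsHomogeneousBasis (modelTwo m) ⊤
    ((basisTwo m).reindex Subgroup.topEquiv.symm.toEquiv) :=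
  (isTwisted_basisTwo m).isHomogeneousBasis_top (modelTwo_eq_span m)

/-! ### The grading groups -/

/-- The isomorphism `(Z_2²)^k × Z_2 ≃ Z_2^{2k+1}`. -/
def planesMulEquiv {k N : ℕ} (hN : N = 2 * k + 1) :
    (Fin k → Z2 × Z2) × Z2 ≃* (Fin N → Z2) :=
  let e : (Fin k ⊕ Fin k) ⊕ Unit ≃ Fin N := Fintype.equivOfCardEq (by simp [hN]; ring)
  let f : (Fin k → Z2 × Z2) × Z2 ≃* ((Fin k ⊕ Fin k) ⊕ Unit → Z2) :=
    { toFun := fun x => Sum.elim (Sum.elim (fun i => (x.1 i).1) fun i => (x.1 i).2) fun _ => x.2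
      invFun := fun y => (fun i => (y (.inl (.inl i)), y (.inl (.inr i))), y (.inr ()))
      left_inv := fun _ => rfl
      right_inv := fun y => by
        funext i
        rcases i with (i | i) | i <;> rfl
      map_mul' := fun x y => by
        funext i
        rcases i with (i | i) | i <;> rfl }
  f.trans (MulEquiv.arrowCongr e (MulEquiv.refl Z2))

/-- The isomorphism `(Z_2²)^k × (Z_2 × Z_4) ≃ Z_2^{2k+1} × Z_4`. -/
def planesProdMulEquiv {k N : ℕ} (hN : N = 2 * k + 1) :
    (Fin k → Z2 × Z2) × (Z2 × Z4) ≃* (Fin N → Z2) × Z4 :=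
  MulEquiv.prodAssoc.symm.trans ((planesMulEquiv hN).prodCongr (MulEquiv.refl Z4))

lemma card_planes (k : ℕ) : Nat.card ((Fin k → Z2 × Z2) × Z2) = 2 ^ (2 * k + 1) := by
  rw [Nat.card_congr (planesMulEquiv (k := k) rfl).toEquiv]
  simp

lemma card_planesProd (k : ℕ) :
    Nat.card ((Fin k → Z2 × Z2) × (Z2 × Z4)) = 2 ^ (2 * (k + 1) + 1) := by
  rw [Nat.card_congr (planesProdMulEquiv (k := k) rfl).toEquiv]
  simp
  ring

lemma supportIsoTo_modelOne (m : ℕ) : SupportIsoTo (modelOne m) (Fin (2 * m + 1) → Z2) :=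
  ⟨⊤, (isHomogeneousBasis_modelOne m).support_eq, ⟨Subgroup.topEquiv.trans (planesMulEquiv rfl)⟩⟩

lemma supportIsoTo_modelTwo {m : ℕ} (hm : 1 ≤ m) :
    SupportIsoTo (modelTwo m) ((Fin (2 * m - 1) → Z2) × Z4) :=
  ⟨⊤, (isHomogeneousBasis_modelTwo m).support_eq,
    ⟨Subgroup.topEquiv.trans (planesProdMulEquiv (by omega))⟩⟩

/-! ### Gradings on matrix algebras and their invariants -/

section Invariants

variable {G D : Type*} [CommGroup G] [Ring D] [Algebra ℝ D]

/-- The signs of the squares of basis elements form a quadratic form on every elementary subgroup,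
and its polarisation is the commutation factor. -/
lemma IsTwisted.isQuadraticForm {T S : Type*} [CommGroup T] [CommGroup S] {b : Basis T ℝ D}
    (hb : IsTwisted b) {μ : T → ℤˣ}
    (hμ : ∀ t, t * t = 1 → b t * b t = (((μ t : ℤˣ) : ℤ) : ℝ) • (1 : D)) (ι : S →* T)
    (hS : ∀ s : S, s * s = 1) :
    IsQuadraticForm (fun s => μ (ι s)) ∧
      ∀ u v, ((hb.comm (ι u) (ι v) : ℝˣ) : ℝ) = ((polar (fun s => μ (ι s)) u v : ℤˣ) : ℤ) := by
  have hι : ∀ s, ι s * ι s = 1 := fun s => by rw [← map_mul, hS, map_one]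
  have hp : ∀ u v, ((hb.comm (ι u) (ι v) : ℝˣ) : ℝ)
      = ((polar (fun s => μ (ι s)) u v : ℤˣ) : ℤ) := fun u v => by
    have h := hb.comm_eq_polar (μ := μ) (hι v) (hμ _ (hι u)) (hμ _ (hι v))
      (hμ _ (by rw [← map_mul, hι]))
    rw [h]
    simp only [polar, map_mul]
  have hinj : ∀ x y : ℤˣ, ((x : ℤ) : ℝ) = ((y : ℤ) : ℝ) → x = y := fun x y h =>
    Units.ext (Int.cast_injective h)
  refine ⟨⟨fun s => by rw [pow_two, hS], ?_, fun u v w => hinj _ _ ?_, fun u v w => hinj _ _ ?_⟩, hp⟩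
  · have h := hμ 1 (one_mul 1)
    rw [hb.one, one_mul, ← hb.one] at h
    rw [map_one]
    refine hinj _ _ (smul_basis_inj (b := b) (t := 1) (h.symm.trans ?_))
    simp
  · rw [Units.val_mul, Int.cast_mul, ← hp, ← hp, ← hp, map_mul, hb.comm_mul_left, Units.val_mul]
  · rw [Units.val_mul, Int.cast_mul, ← hp, ← hp, ← hp, map_mul, hb.comm_mul_right, Units.val_mul]

lemma radical_eq_of_eq {T : Type*} {β : T → T → ℝˣ} {γ : T → T → ℤˣ}
    (h : ∀ u v, ((β u v : ℝˣ) : ℝ) = ((γ u v : ℤˣ) : ℤ)) : radical β = radical γ := by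
  ext t
  refine forall_congr' fun u => ?_
  rw [← Units.val_eq_one, h, Int.cast_eq_one, Units.val_eq_one]

/-- The sign of the square of a homogeneous element does not depend on the element. -/
lemma IsHomogeneousBasis.sign_unique {Γ : Family G D} {T : Subgroup G} {b : Basis T ℝ D}
    (hb : IsHomogeneousBasis Γ T b) {t : T} {X : D} (hX : X ∈ Γ t) {ε δ : ℤˣ}
    (h : b t * b t = (((ε : ℤˣ) : ℤ) : ℝ) • (1 : D))
    (h' : X * X = (((δ : ℤˣ) : ℤ) : ℝ) • (1 : D)) : ε = δ := by
  obtain ⟨c, rfl⟩ := hb.mem_iff.1 hX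
  rw [smul_mul_smul_comm, h, smul_smul, ← hb.one] at h'
  have h := smul_basis_inj h'
  rcases Int.units_eq_one_or ε with rfl | rfl <;> rcases Int.units_eq_one_or δ with rfl | rfl
  · rfl
  · norm_num at h
    nlinarith [mul_self_nonneg c]
  · norm_num at h
    nlinarith [mul_self_nonneg c]
  · rfl

/-- The invariants of a division grading with one-dimensional components on `M_n(ℂ)`. -/
lemma IsDimOneDivisionGrading.exists_data {n : ℕ} (hn : 1 ≤ n)
    (e : D ≃ₐ[ℝ] Matrix (Fin n) (Fin n) ℂ) {Γ : Family G D} (hΓ : IsDimOneDivisionGrading Γ) :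
    ∃ (T : Subgroup G) (b : Basis T ℝ D) (μ : T → ℤˣ) (hb : IsHomogeneousBasis Γ T b) (f : T),
      (∀ t, t * t = 1 → b t * b t = (((μ t : ℤˣ) : ℤ) : ℝ) • (1 : D)) ∧
      f ≠ 1 ∧ radical hb.toIsTwisted.comm = {1, f} ∧ f * f = 1 ∧ μ f = -1 ∧
      Finite T ∧ Nat.card T = 2 * n ^ 2 := by
  have : NeZero n := ⟨by omega⟩
  have : Nontrivial D := e.toEquiv.nontrivial
  have : FiniteDimensional ℝ D := Module.Finite.equiv e.toLinearEquiv.symm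
  obtain ⟨T, b₀, hb₀⟩ := hΓ.exists_basis
  obtain ⟨b, μ, hb, hμ⟩ := hb₀.exists_normalized
  obtain ⟨f, hf1, hr, hff, r, hr0, hbf⟩ := hb.toIsTwisted.exists_radical_eq hn e
  refine ⟨T, b, μ, hb, f, hμ, hf1, hr, hff, ?_, Module.Finite.finite_basis b, ?_⟩
  · rw [hμ f hff, ← hb.one] at hbf
    have h := smul_basis_inj hbf
    rcases Int.units_eq_one_or (μ f) with h1 | h1
    · rw [h1] at h
      norm_num at h
      linarith
    · exact h1
  · rw [← finrank_eq_nat_card_basis b, e.toLinearEquiv.finrank_eq, Module.finrank_matrix]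
    simp
    ring

lemma exists_mul_self_eq {T : Type*} [CommGroup T] [Finite T] {β : T → T → ℝˣ}
    (hβ : IsAlternatingBicharacter β) {f : T} (hr : radical β = {1, f})
    (h : ∃ t : T, t * t ≠ 1) : ∃ t : T, t * t = f := by
  obtain ⟨t, ht⟩ := h
  have := hβ.mul_self_mem_radical t
  rw [hr] at this
  exact ⟨t, this.resolve_left ht⟩

lemma mul_self_of_mulEquiv {T : Type*} [CommGroup T] {N : ℕ} (i : T ≃* (Fin N → Z2)) (t : T) :
    t * t = 1 := by
  apply i.injective
  rw [map_mul, map_one]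
  have : ∀ z : Z2, z * z = 1 := by decide
  exact funext fun j => this _

lemma pow_four_of_mulEquiv {T : Type*} [CommGroup T] {N : ℕ} (i : T ≃* (Fin N → Z2) × Z4) (t : T) :
    t ^ 4 = 1 := by
  apply i.injective
  rw [map_pow, map_one]
  have h2 : ∀ z : Z2, z ^ 4 = 1 := by decide
  have h4 : ∀ z : Z4, z ^ 4 = 1 := by decide
  exact Prod.ext (funext fun j => h2 _) (h4 _)

lemma exists_mul_self_ne_one {T A : Type*} [CommGroup T] [CommGroup A] (i : T ≃* A × Z4) :
    ∃ t : T, t * t ≠ 1 := by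
  refine ⟨i.symm (1, Multiplicative.ofAdd 1), fun h => ?_⟩
  rw [← map_mul, i.symm.map_eq_one_iff, Prod.mk_mul_mk, Prod.mk_eq_one] at h
  exact absurd h.2 (by decide)

/-- The order of the matrices and the isomorphism type of the support, read off from the normal
forms of the invariants. -/
theorem IsDimOneDivisionGrading.exists_supportIsoTo {n : ℕ} (hn : 1 ≤ n)
    (e : D ≃ₐ[ℝ] Matrix (Fin n) (Fin n) ℂ) {Γ : Family G D} (hΓ : IsDimOneDivisionGrading Γ) :
    ∃ m : ℕ, n = 2 ^ m ∧ (SupportIsoTo Γ (Fin (2 * m + 1) → Z2) ∨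
      (1 ≤ m ∧ SupportIsoTo Γ ((Fin (2 * m - 1) → Z2) × Z4))) := by
  obtain ⟨T, b, μ, hb, f, hμ, hf1, hr, hff, hμf, hfin, hcard⟩ := hΓ.exists_data hn e
  have hpow : ∀ k, Nat.card T = 2 ^ (2 * k + 1) → n = 2 ^ k := fun k h => by
    rw [h, pow_succ, mul_comm, pow_mul'] at hcard
    exact (Nat.pow_left_injective two_ne_zero (Nat.eq_of_mul_eq_mul_left two_pos hcard)).symm
  by_cases hall : ∀ t : T, t * t = 1
  · obtain ⟨hq, hp⟩ := hb.toIsTwisted.isQuadraticForm hμ (MonoidHom.id T) hall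
    have hr' : radical (polar μ) = {1, f} := (radical_eq_of_eq hp).symm.trans hr
    obtain ⟨k, ψ, -, -⟩ := IsQuadraticForm.exists_normalForm (μ := μ) hq hμf hr'
    refine ⟨k, hpow k ?_, Or.inl ⟨T, hb.support_eq, ⟨ψ.symm.trans (planesMulEquiv rfl)⟩⟩⟩
    rw [← Nat.card_congr ψ.toEquiv, card_planes]
  · push Not at hall
    obtain ⟨t, ht⟩ := exists_mul_self_eq hb.toIsTwisted.isAlternatingBicharacter hr hall
    obtain ⟨hq, hp⟩ := hb.toIsTwisted.isQuadraticForm hμ (twoTorsion T).subtype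
      fun s => Subtype.ext (mem_twoTorsion.1 s.2)
    obtain ⟨k, ψ, -, -⟩ := exists_normalForm_bicharacter
      hb.toIsTwisted.isAlternatingBicharacter hf1 hr ht hq hp ⟨mem_twoTorsion.2 hff, hμf⟩
    refine ⟨k + 1, hpow (k + 1) ?_, Or.inr ⟨by omega, T, hb.support_eq,
      ⟨ψ.symm.trans (planesProdMulEquiv (by omega))⟩⟩⟩
    rw [← Nat.card_congr ψ.toEquiv, card_planesProd]

end Invariants

/-! ### Classification up to isomorphism -/

/-- A relation that is functional on classes, injective and surjective defines a bijection. -/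
lemma exists_quotient_equiv {α β : Type*} [s : Setoid α] (R : β → α → Prop)
    (hex : ∀ a, ∃ p, R p a) (huniq : ∀ a p q, R p a → R q a → p = q)
    (hinv : ∀ a a' p, a ≈ a' → R p a → R p a') (hinj : ∀ a a' p, R p a → R p a' → a ≈ a')
    (hsurj : ∀ p, ∃ a, R p a) : ∃ Φ : Quotient s ≃ β, ∀ a, R (Φ ⟦a⟧) a := by
  -- send a class to the unique element related to its representatives
  choose F hF using hex
  let f : Quotient s → β := Quotient.lift F
    fun a a' h => huniq a' _ _ (hinv a a' _ h (hF a)) (hF a')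
  refine ⟨Equiv.ofBijective f ⟨?_, fun p => ?_⟩, hF⟩
  · rintro ⟨a⟩ ⟨a'⟩ h
    exact Quotient.sound (hinj a a' (F a) (hF a) ((show F a = F a' from h) ▸ hF a'))
  · obtain ⟨a, ha⟩ := hsurj p
    exact ⟨⟦a⟧, huniq a _ _ (hF a) ha⟩

section Attached

variable {G : Type*} [CommGroup G] {D : Type*} [Ring D] [Algebra ℝ D]

lemma Isomorphic.support_eq {G D D' : Type*} [Ring D] [Algebra ℝ D] [Ring D'] [Algebra ℝ D']
    {Γ : Family G D}
    {Γ' : Family G D'} (h : Isomorphic Γ Γ') : support Γ = support Γ' := by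
  obtain ⟨φ, hφ⟩ := h
  ext g
  have : (Γ g).map φ.toLinearMap = ⊥ ↔ Γ g = ⊥ :=
    Submodule.map_eq_bot_iff (e := φ.toLinearEquiv)
  simp only [support, Set.mem_ofPred_eq, Ne, ← hφ g, this]

lemma exists_sq_of_map {G D : Type*} [Ring D] [Algebra ℝ D] {Γ Γ' : Family G D} {φ : D ≃ₐ[ℝ] D}
    (hφ : ∀ g, (Γ g).map φ.toLinearMap = Γ' g) {g : G} {c : ℝ}
    (h : ∃ X ∈ Γ g, X * X = c • (1 : D)) : ∃ X ∈ Γ' g, X * X = c • (1 : D) := by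
  obtain ⟨X, hX, hXX⟩ := h
  refine ⟨φ X, ?_, by rw [← map_mul, hXX, map_smul, map_one]⟩
  rw [← hφ]
  exact Submodule.mem_map_of_mem (f := φ.toLinearMap) hX

lemma QuadPair.IsAttachedTo.of_isomorphic {m : ℕ} {p : QuadPair G m} {Γ Γ' : Family G D}
    (hp : p.IsAttachedTo Γ) (h : Isomorphic Γ Γ') : p.IsAttachedTo Γ' where
  support_eq := hp.support_eq.trans h.support_eq
  sq_eq t := by
    obtain ⟨φ, hφ⟩ := h
    exact exists_sq_of_map hφ (hp.sq_eq t)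

lemma QuadTriple.IsAttachedTo.of_isomorphic {m : ℕ} {p : QuadTriple G m} {Γ Γ' : Family G D}
    (hp : p.IsAttachedTo Γ) (h : Isomorphic Γ Γ') : p.IsAttachedTo Γ' where
  support_eq := hp.support_eq.trans h.support_eq
  comm_eq u v X hX Y hY := by
    obtain ⟨φ, hφ⟩ := h
    rw [← hφ] at hX hY
    obtain ⟨X, hX, rfl⟩ := hX
    obtain ⟨Y, hY, rfl⟩ := hY
    have := congrArg φ (hp.comm_eq u v X hX Y hY)
    rwa [map_smul, map_mul, map_mul] at this
  sq_eq t := by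
    obtain ⟨φ, hφ⟩ := h
    exact exists_sq_of_map hφ (hp.sq_eq t)

variable {n : ℕ} (hn : 1 ≤ n) (e : D ≃ₐ[ℝ] Matrix (Fin n) (Fin n) ℂ)

include hn e

lemma QuadPair.IsAttachedTo.exists_basis {m : ℕ} {p : QuadPair G m} {Γ : Family G D}
    (hp : p.IsAttachedTo Γ) (hΓ : IsDimOneDivisionGrading Γ) :
    ∃ b : Basis p.T ℝ D, IsHomogeneousBasis Γ p.T b ∧ Finite p.T ∧
      ∀ t, b t * b t = (((p.μ t : ℤˣ) : ℤ) : ℝ) • (1 : D) := by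
  obtain ⟨T, b, μ, hb, f, hμ, -, -, -, -, hfin, -⟩ := hΓ.exists_data hn e
  obtain ⟨T', μ', iso, quad, hII⟩ := p
  obtain rfl : T' = T := SetLike.coe_injective (hp.support_eq.trans hb.support_eq.symm)
  refine ⟨b, hb, hfin, fun t => ?_⟩
  obtain ⟨X, hX, hXX⟩ := hp.sq_eq t
  have ht := hμ t (quad.mul_self t)
  rw [ht, hb.sign_unique hX ht hXX]

lemma QuadTriple.IsAttachedTo.exists_basis {m : ℕ} {p : QuadTriple G m} {Γ : Family G D}
    (hp : p.IsAttachedTo Γ) (hΓ : IsDimOneDivisionGrading Γ) :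
    ∃ (b : Basis p.T ℝ D) (hb : IsHomogeneousBasis Γ p.T b), Finite p.T ∧
      hb.toIsTwisted.comm = p.β ∧
      ∀ t : twoTorsion p.T, b t * b t = (((p.μ t : ℤˣ) : ℤ) : ℝ) • (1 : D) := by
  obtain ⟨T, b, μ, hb, f, hμ, -, -, -, -, hfin, -⟩ := hΓ.exists_data hn e
  obtain ⟨T', β, μ', iso, alt, hII, quad, hres, hgen⟩ := p
  obtain rfl : T' = T := SetLike.coe_injective (hp.support_eq.trans hb.support_eq.symm)
  refine ⟨b, hb, hfin, ?_, fun t => ?_⟩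
  · funext u v
    exact (Units.ext (hb.toIsTwisted.comm_unique
      (hp.comm_eq u v _ (hb.basis_mem u) _ (hb.basis_mem v)))).symm
  · obtain ⟨X, hX, hXX⟩ := hp.sq_eq t
    have ht := hμ t (mem_twoTorsion.1 t.2)
    rw [ht, hb.sign_unique hX ht hXX]

lemma QuadPair.IsAttachedTo.unique {m : ℕ} {p q : QuadPair G m} {Γ : Family G D}
    (hp : p.IsAttachedTo Γ) (hq : q.IsAttachedTo Γ) (hΓ : IsDimOneDivisionGrading Γ) : p = q := by
  obtain ⟨b, hb, -, hμ⟩ := hp.exists_basis hn e hΓ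
  obtain ⟨T, μ, iso, quad, hII⟩ := p
  obtain ⟨T', μ', iso', quad', hII'⟩ := q
  obtain rfl : T = T' := SetLike.coe_injective (hp.support_eq.trans hq.support_eq.symm)
  obtain rfl : μ = μ' := funext fun t => by
    obtain ⟨X, hX, hXX⟩ := hq.sq_eq t
    exact hb.sign_unique hX (hμ t) hXX
  rfl

lemma QuadTriple.IsAttachedTo.unique {m : ℕ} {p q : QuadTriple G m} {Γ : Family G D}
    (hp : p.IsAttachedTo Γ) (hq : q.IsAttachedTo Γ) (hΓ : IsDimOneDivisionGrading Γ) : p = q := by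
  obtain ⟨b, hb, -, hβ, hμ⟩ := hp.exists_basis hn e hΓ
  obtain ⟨T, β, μ, iso, alt, hII, quad, hres, hgen⟩ := p
  obtain ⟨T', β', μ', iso', alt', hII', quad', hres', hgen'⟩ := q
  obtain rfl : T = T' := SetLike.coe_injective (hp.support_eq.trans hq.support_eq.symm)
  obtain rfl : β = β' := by
    rw [← show _ = β from hβ]
    funext u v
    exact (Units.ext (hb.toIsTwisted.comm_unique
      (hq.comm_eq u v _ (hb.basis_mem u) _ (hb.basis_mem v)))).symm
  obtain rfl : μ = μ' := funext fun t => by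
    obtain ⟨X, hX, hXX⟩ := hq.sq_eq t
    exact hb.sign_unique hX (hμ t) hXX
  rfl

lemma QuadPair.exists_isAttachedTo {m : ℕ} {Γ : Family G D} (hΓ : IsDimOneDivisionGrading Γ)
    (hs : SupportIsoTo Γ (Fin (2 * m + 1) → Z2)) : ∃ p : QuadPair G m, p.IsAttachedTo Γ := by
  obtain ⟨T, b, μ, hb, f, hμ, hf1, hr, hff, hμf, hfin, -⟩ := hΓ.exists_data hn e
  obtain ⟨T', hT', iso⟩ := hs
  obtain rfl : T' = T := SetLike.coe_injective (hT'.trans hb.support_eq.symm)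
  have hall := mul_self_of_mulEquiv iso.some
  obtain ⟨hq, hp⟩ := hb.toIsTwisted.isQuadraticForm hμ (MonoidHom.id T') hall
  have hr' : radical (polar μ) = {1, f} := (radical_eq_of_eq hp).symm.trans hr
  exact ⟨⟨T', μ, iso, hq, f, hμf, hr'⟩, hT', fun t => ⟨b t, hb.basis_mem t, hμ t (hall t)⟩⟩

lemma QuadTriple.exists_isAttachedTo {m : ℕ} {Γ : Family G D} (hΓ : IsDimOneDivisionGrading Γ)
    (hs : SupportIsoTo Γ ((Fin (2 * m - 1) → Z2) × Z4)) :
    ∃ p : QuadTriple G m, p.IsAttachedTo Γ := by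
  obtain ⟨T, b, μ, hb, f, hμ, hf1, hr, hff, hμf, hfin, -⟩ := hΓ.exists_data hn e
  obtain ⟨T', hT', iso⟩ := hs
  obtain rfl : T' = T := SetLike.coe_injective (hT'.trans hb.support_eq.symm)
  have halt := hb.toIsTwisted.isAlternatingBicharacter
  obtain ⟨t, ht⟩ := exists_mul_self_eq halt hr (exists_mul_self_ne_one iso.some)
  obtain ⟨hq, hp⟩ := hb.toIsTwisted.isQuadraticForm hμ (twoTorsion T').subtype
    fun s => Subtype.ext (mem_twoTorsion.1 s.2)
  have hgen : Subgroup.zpowers f = squares T' := by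
    refine le_antisymm ?_ ?_
    · rw [Subgroup.zpowers_le]
      exact ⟨t, (pow_two t).trans ht⟩
    · rintro _ ⟨s, rfl⟩
      have := halt.mul_self_mem_radical s
      rw [hr, ← pow_two] at this
      rcases this with h | h
      · rw [powMonoidHom_apply, h]
        exact one_mem _
      · rw [powMonoidHom_apply, h]
        exact Subgroup.mem_zpowers f
  exact ⟨⟨T', hb.toIsTwisted.comm, fun s => μ s, iso, halt, ⟨f, hf1, hr⟩, hq, hp,
    ⟨f, mem_twoTorsion.2 hff⟩, hgen, hμf⟩, hT', fun u v X hX Y hY => hb.comm_eq u v hX hY,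
    fun s => ⟨b s, hb.basis_mem s, hμ s (mem_twoTorsion.1 s.2)⟩⟩

lemma QuadPair.IsAttachedTo.isomorphic {m : ℕ} {p : QuadPair G m} {Γ Γ' : Family G D}
    (hp : p.IsAttachedTo Γ) (hp' : p.IsAttachedTo Γ') (hΓ : IsDimOneDivisionGrading Γ)
    (hΓ' : IsDimOneDivisionGrading Γ') : Isomorphic Γ Γ' := by
  obtain ⟨b, hb, hfin, hμ⟩ := hp.exists_basis hn e hΓ
  obtain ⟨b', hb', -, hμ'⟩ := hp'.exists_basis hn e hΓ'
  refine hb.isomorphic hb' (fun t => ?_) (fun u v => Units.ext ?_) fun t _ => ⟨_, hμ t, hμ' t⟩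
  · rw [show 4 = 2 * 2 by norm_num, pow_mul, p.quad.elementary]
  · rw [hb.toIsTwisted.comm_eq_polar (p.quad.mul_self v) (hμ u) (hμ v) (hμ _),
      hb'.toIsTwisted.comm_eq_polar (p.quad.mul_self v) (hμ' u) (hμ' v) (hμ' _)]

lemma QuadTriple.IsAttachedTo.isomorphic {m : ℕ} {p : QuadTriple G m} {Γ Γ' : Family G D}
    (hp : p.IsAttachedTo Γ) (hp' : p.IsAttachedTo Γ') (hΓ : IsDimOneDivisionGrading Γ)
    (hΓ' : IsDimOneDivisionGrading Γ') : Isomorphic Γ Γ' := by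
  obtain ⟨b, hb, hfin, hβ, hμ⟩ := hp.exists_basis hn e hΓ
  obtain ⟨b', hb', -, hβ', hμ'⟩ := hp'.exists_basis hn e hΓ'
  refine hb.isomorphic hb' (pow_four_of_mulEquiv p.iso.some) (fun u v => by rw [hβ, hβ'])
    fun t ht => ⟨_, hμ ⟨t, mem_twoTorsion.2 ht⟩, hμ' ⟨t, mem_twoTorsion.2 ht⟩⟩

end Attached

section Normal

variable {G : Type*} [CommGroup G]

lemma QuadPair.exists_normalForm {m : ℕ} (p : QuadPair G m) :
    ∃ ψ : (Fin m → Z2 × Z2) × Z2 ≃* p.T, ∀ x, p.μ (ψ x) = formOne m x := by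
  have : Finite p.T := Finite.of_equiv _ p.iso.some.symm.toEquiv
  obtain ⟨f, hf, hr⟩ := p.typeII
  obtain ⟨k, ψ, hψ, -⟩ := p.quad.exists_normalForm hf hr
  obtain rfl : k = m := by
    have h := Nat.card_congr (ψ.trans p.iso.some).toEquiv
    rw [card_planes] at h
    have : 2 * k + 1 = 2 * m + 1 := Nat.pow_right_injective le_rfl (h.trans (by simp))
    omega
  exact ⟨ψ, hψ⟩

lemma QuadTriple.exists_normalForm {m : ℕ} (hm : 1 ≤ m) (p : QuadTriple G m) :
    ∃ ψ : (Fin (m - 1) → Z2 × Z2) × (Z2 × Z4) ≃* p.T,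
      (∀ x y, ((p.β (ψ x) (ψ y) : ℝˣ) : ℝ) = ((bicharTwo (m - 1) x y : ℤˣ) : ℤ)) ∧
      ∀ x (h : ψ x ∈ twoTorsion p.T), p.μ ⟨ψ x, h⟩ = formTwo (m - 1) x := by
  have : Finite p.T := Finite.of_equiv _ p.iso.some.symm.toEquiv
  obtain ⟨f, hf1, hr⟩ := p.typeII
  obtain ⟨f', hgen, hf'⟩ := p.map_gen
  -- the generator of the squares is the nontrivial element of the radical
  obtain ⟨b, hb⟩ : (f' : p.T) ∈ squares p.T := hgen ▸ Subgroup.mem_zpowers _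
  have hb : b * b = f' := (pow_two b).symm.trans hb
  have hff' : (f' : p.T) = f := by
    have h := p.alternating.mul_self_mem_radical b
    rw [hr, hb] at h
    rcases h with h | h
    · rw [show f' = 1 from Subtype.ext h, p.quad.map_one] at hf'
      exact absurd hf' (by decide)
    · exact h
  obtain ⟨k, ψ, hψ, hψ'⟩ := exists_normalForm_bicharacter p.alternating hf1 hr (hb.trans hff')
    p.quad p.restrict ⟨hff' ▸ f'.2, by
      rw [← hf']
      exact congrArg p.μ (Subtype.ext hff'.symm)⟩
  obtain rfl : k = m - 1 := by
    have h := Nat.card_congr (ψ.trans p.iso.some).toEquiv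
    rw [card_planesProd] at h
    have h2 : Nat.card ((Fin (2 * m - 1) → Z2) × Z4) = 2 ^ (2 * m + 1) := by
      simp only [Nat.card_eq_fintype_card, Fintype.card_prod, Fintype.card_pi_const,
        Fintype.card_multiplicative, ZMod.card]
      rw [show 2 * m + 1 = (2 * m - 1) + 2 by omega, pow_add]
      norm_num
    have : 2 * (k + 1) + 1 = 2 * m + 1 := Nat.pow_right_injective le_rfl (h.trans h2)
    omega
  exact ⟨ψ, hψ, hψ'⟩

variable {D : Type*} [Ring D] [Algebra ℝ D]

/-- Every pair `(T, μ)` is realised, by transporting the product grading. -/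
lemma QuadPair.exists_grading {m : ℕ} (p : QuadPair G m) (φ : AlgebraOne m ≃ₐ[ℝ] D) :
    ∃ Γ : DimOneGrading G D (Fin (2 * m + 1) → Z2), p.IsAttachedTo Γ.1 := by
  obtain ⟨ψ, hψ⟩ := p.exists_normalForm
  let b : Basis p.T ℝ D := ((basisOne m).reindex ψ.toEquiv).map φ.toLinearEquiv
  have hb := isHomogeneousBasis_familyOfBasis (((isTwisted_basisOne m).reindex ψ).map φ)
  have hsq : ∀ t, b t * b t = (((p.μ t : ℤˣ) : ℤ) : ℝ) • (1 : D) := fun t => by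
    have h := congrArg φ (basisOne_mul_self m (ψ.symm t))
    rw [map_mul, map_smul, map_one, ← hψ, ψ.apply_symm_apply] at h
    simpa [b] using h
  exact ⟨⟨familyOfBasis p.T b, hb.isDimOneDivisionGrading, p.T, hb.support_eq, p.iso⟩,
    hb.support_eq, fun t => ⟨b t, hb.basis_mem t, hsq t⟩⟩

/-- Every triple `(T, β, μ)` is realised, by transporting the product grading. -/
lemma QuadTriple.exists_grading {m : ℕ} (hm : 1 ≤ m) (p : QuadTriple G m)
    (φ : AlgebraTwo m ≃ₐ[ℝ] D) :
    ∃ Γ : DimOneGrading G D ((Fin (2 * m - 1) → Z2) × Z4), p.IsAttachedTo Γ.1 := by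
  obtain ⟨ψ, hβ, hμ⟩ := p.exists_normalForm hm
  let b : Basis p.T ℝ D := ((basisTwo m).reindex ψ.toEquiv).map φ.toLinearEquiv
  have ht := (isTwisted_basisTwo m).reindex ψ
  have hb := isHomogeneousBasis_familyOfBasis (ht.map φ)
  have hsq : ∀ t : twoTorsion p.T, b t * b t = (((p.μ t : ℤˣ) : ℤ) : ℝ) • (1 : D) := fun t => by
    have h1 : ψ.symm t * ψ.symm t = 1 := by rw [← map_mul, mem_twoTorsion.1 t.2, map_one]
    have h := congrArg φ (basisTwo_mul_self m h1)
    have h2 := hμ (ψ.symm t) (by rw [ψ.apply_symm_apply]; exact t.2)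
    simp only [ψ.apply_symm_apply] at h2
    rw [map_mul, map_smul, map_one, ← h2] at h
    simpa [b] using h
  have hcomm : ∀ u v, hb.toIsTwisted.comm u v = p.β u v := fun u v => by
    have h : hb.toIsTwisted.comm u v = _ := ht.comm_map φ u v
    rw [h, (isTwisted_basisTwo m).comm_reindex]
    ext
    rw [comm_basisTwo, ← hβ, ψ.apply_symm_apply, ψ.apply_symm_apply]
  exact ⟨⟨familyOfBasis p.T b, hb.isDimOneDivisionGrading, p.T, hb.support_eq, p.iso⟩,
    hb.support_eq, fun u v X hX Y hY => by rw [← hcomm]; exact hb.comm_eq u v hX hY,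
    fun t => ⟨b t, hb.basis_mem t, hsq t⟩⟩

lemma QuadPair.IsAttachedTo.equivalent {n : ℕ} (hn : 1 ≤ n)
    (e : D ≃ₐ[ℝ] Matrix (Fin n) (Fin n) ℂ) {m : ℕ} {p : QuadPair G m} {Γ : Family G D}
    (hp : p.IsAttachedTo Γ) (hΓ : IsDimOneDivisionGrading Γ) : Equivalent Γ (modelOne m) := by
  obtain ⟨b, hb, hfin, hμ⟩ := hp.exists_basis hn e hΓ
  obtain ⟨ψ, hψ⟩ := p.exists_normalForm
  have hb' := isHomogeneousBasis_modelOne m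
  have hsq : ∀ t, basisOne m (ψ.symm t) * basisOne m (ψ.symm t)
      = (((p.μ t : ℤˣ) : ℤ) : ℝ) • (1 : AlgebraOne m) := fun t => by
    rw [basisOne_mul_self, ← hψ, ψ.apply_symm_apply]
  refine hb.equivalent hb' (ψ.symm.trans Subgroup.topEquiv.symm) (fun t => ?_)
    (fun u v => Units.ext ?_) fun t _ => ⟨_, hμ t, by simpa using hsq t⟩
  · rw [show 4 = 2 * 2 by norm_num, pow_mul, p.quad.elementary]
  · rw [hb.toIsTwisted.comm_eq_polar (p.quad.mul_self v) (hμ u) (hμ v) (hμ _)]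
    have h : hb'.toIsTwisted.comm _ _ = _ := (isTwisted_basisOne m).comm_reindex
      Subgroup.topEquiv.symm (Subgroup.topEquiv.symm (ψ.symm u)) (Subgroup.topEquiv.symm (ψ.symm v))
    refine Eq.trans ?_ (congrArg Units.val h).symm
    simp only [MulEquiv.symm_symm, MulEquiv.apply_symm_apply]
    rw [(isTwisted_basisOne m).comm_eq_polar (μ := fun x => p.μ (ψ x)) _ (by simpa using hsq u)
      (by simpa using hsq v) (by simpa using hsq (u * v))]
    · simp [polar]
    · rw [← map_mul, p.quad.mul_self, map_one]

lemma QuadTriple.IsAttachedTo.equivalent {n : ℕ} (hn : 1 ≤ n)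
    (e : D ≃ₐ[ℝ] Matrix (Fin n) (Fin n) ℂ) {m : ℕ} (hm : 1 ≤ m) {p : QuadTriple G m}
    {Γ : Family G D} (hp : p.IsAttachedTo Γ) (hΓ : IsDimOneDivisionGrading Γ) :
    Equivalent Γ (modelTwo m) := by
  obtain ⟨b, hb, hfin, hβ, hμ⟩ := hp.exists_basis hn e hΓ
  obtain ⟨ψ, hψβ, hψμ⟩ := p.exists_normalForm hm
  have hb' := isHomogeneousBasis_modelTwo m
  refine hb.equivalent hb' (ψ.symm.trans Subgroup.topEquiv.symm)
    (pow_four_of_mulEquiv p.iso.some) (fun u v => Units.ext ?_)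
    fun t ht => ⟨_, hμ ⟨t, mem_twoTorsion.2 ht⟩, ?_⟩
  · have h : hb'.toIsTwisted.comm _ _ = _ := (isTwisted_basisTwo m).comm_reindex
      Subgroup.topEquiv.symm (Subgroup.topEquiv.symm (ψ.symm u)) (Subgroup.topEquiv.symm (ψ.symm v))
    refine Eq.trans ?_ (congrArg Units.val h).symm
    simp only [MulEquiv.symm_symm, MulEquiv.apply_symm_apply]
    rw [comm_basisTwo, ← hψβ, ψ.apply_symm_apply, ψ.apply_symm_apply, hβ]
  · have h1 : ψ.symm t * ψ.symm t = 1 := by rw [← map_mul, ht, map_one]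
    have h := basisTwo_mul_self m h1
    have h2 := hψμ (ψ.symm t) (by rw [ψ.apply_symm_apply]; exact mem_twoTorsion.2 ht)
    simp only [ψ.apply_symm_apply] at h2
    rw [← h2] at h
    simpa using h

end Normal

end RealGrading

end

open RealGrading
theorem mainTheorem2 {G : Type*} [CommGroup G] {D : Type*} [Ring D] [Algebra ℝ D]
    (n : ℕ) (hn : 1 ≤ n) (hD : Nonempty (D ≃ₐ[ℝ] Matrix (Fin n) (Fin n) ℂ)) :
    -- the order of the matrices and the support
    (∀ Γ : Family G D, IsDimOneDivisionGrading Γ →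
      ∃ m : ℕ, n = 2 ^ m ∧
        (SupportIsoTo Γ (Fin (2 * m + 1) → Z2) ∨
          (1 ≤ m ∧ SupportIsoTo Γ ((Fin (2 * m - 1) → Z2) × Z4)))) ∧
    -- (1) support isomorphic to `Z_2^{2m+1}`
    (∀ m : ℕ, n = 2 ^ m →
      (∃ Φ : IsoClasses G D (Fin (2 * m + 1) → Z2) ≃ QuadPair G m,
        ∀ Γ : DimOneGrading G D (Fin (2 * m + 1) → Z2), (Φ ⟦Γ⟧).IsAttachedTo Γ.1) ∧
      (Nonempty (AlgebraOne m ≃ₐ[ℝ] Matrix (Fin n) (Fin n) ℂ) ∧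
        IsDimOneDivisionGrading (modelOne m) ∧
        SupportIsoTo (modelOne m) (Fin (2 * m + 1) → Z2) ∧
        ∀ Γ : DimOneGrading G D (Fin (2 * m + 1) → Z2), Equivalent Γ.1 (modelOne m))) ∧
    -- (2) support isomorphic to `Z_2^{2m-1} × Z_4`
    (∀ m : ℕ, 1 ≤ m → n = 2 ^ m →
      (∃ Φ : IsoClasses G D ((Fin (2 * m - 1) → Z2) × Z4) ≃ QuadTriple G m,
        ∀ Γ : DimOneGrading G D ((Fin (2 * m - 1) → Z2) × Z4), (Φ ⟦Γ⟧).IsAttachedTo Γ.1) ∧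
      (Nonempty (AlgebraTwo m ≃ₐ[ℝ] Matrix (Fin n) (Fin n) ℂ) ∧
        IsDimOneDivisionGrading (modelTwo m) ∧
        SupportIsoTo (modelTwo m) ((Fin (2 * m - 1) → Z2) × Z4) ∧
        ∀ Γ : DimOneGrading G D ((Fin (2 * m - 1) → Z2) × Z4), Equivalent Γ.1 (modelTwo m))) := by
  obtain ⟨e⟩ := hD
  refine ⟨fun Γ hΓ => hΓ.exists_supportIsoTo hn e, fun m hm => ⟨?_, ?_, ?_, ?_, ?_⟩,
    fun m hm1 hm => ⟨?_, ?_, ?_, ?_, ?_⟩⟩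
  · obtain ⟨φ⟩ := nonempty_algebraOne_equiv hm
    exact exists_quotient_equiv
      (fun (p : QuadPair G m) (Γ : DimOneGrading G D (Fin (2 * m + 1) → Z2)) => p.IsAttachedTo Γ.1)
      (fun Γ => QuadPair.exists_isAttachedTo hn e Γ.2.1 Γ.2.2)
      (fun Γ p q hp hq => hp.unique hn e hq Γ.2.1)
      (fun Γ Γ' p h hp => hp.of_isomorphic h)
      (fun Γ Γ' p hp hp' => hp.isomorphic hn e hp' Γ.2.1 Γ'.2.1)
      (fun p => p.exists_grading (φ.trans e.symm))
  · exact nonempty_algebraOne_equiv hm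
  · exact (isHomogeneousBasis_modelOne m).isDimOneDivisionGrading
  · exact supportIsoTo_modelOne m
  · intro Γ
    obtain ⟨p, hp⟩ := QuadPair.exists_isAttachedTo hn e Γ.2.1 Γ.2.2
    exact hp.equivalent hn e Γ.2.1
  · obtain ⟨φ⟩ := nonempty_algebraTwo_equiv hm1 hm
    exact exists_quotient_equiv
      (fun (p : QuadTriple G m) (Γ : DimOneGrading G D ((Fin (2 * m - 1) → Z2) × Z4)) =>
        p.IsAttachedTo Γ.1)
      (fun Γ => QuadTriple.exists_isAttachedTo hn e Γ.2.1 Γ.2.2)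
      (fun Γ p q hp hq => hp.unique hn e hq Γ.2.1)
      (fun Γ Γ' p h hp => hp.of_isomorphic h)
      (fun Γ Γ' p hp hp' => hp.isomorphic hn e hp' Γ.2.1 Γ'.2.1)
      (fun p => p.exists_grading hm1 (φ.trans e.symm))
  · exact nonempty_algebraTwo_equiv hm1 hm
  · exact (isHomogeneousBasis_modelTwo m).isDimOneDivisionGrading
  · exact supportIsoTo_modelTwo hm1
  · intro Γ
    obtain ⟨p, hp⟩ := QuadTriple.exists_isAttachedTo hn e Γ.2.1 Γ.2.2
    exact hp.equivalent hn e hm1 Γ.2.1
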